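/- **Setting.** Let $\mathcal{Y}=[0,1]^d$, let $\mathcal{A}$ be a finite nonempty action set, $\mathcal{X}$ any context set, $\mathcal{C}$ a finite collection of policies $c:\mathcal{X}\to\mathcal{A}$, $T\ge 1$, $\eta,\gamma>0$, and let $\mathcal{L}$ be a nonempty (possibly infinite) family of losses $\ell:\mathcal{A}\times\mathcal{Y}\to[0,1]$. For a loss $\ell$, the smooth (quantal) best response to $p$ is the distribution $q^\ell(\cdot,p)$ on $\mathcal{A}$ with $q^\ell(a,p)\propto e^{-\eta\,\ell(a,p)}$. Let $s=(s_1,\dots,s_n)$, $n\ge 1$, $s_i:\mathcal{Y}\to[0,1]$, be an $(n,\lambda,\delta)$-approximate basis for $\mathcal{L}$, $\lambda\ge0$: for all $\ell\in\mathcal{L}$, $a\in\mathcal{A}$ there are reals $r_0,\dots,r_n$ with $|r_0+\sum_i r_is_i(y)-\ell(a,y)|\le\delta$ and $|\sum_i r_is_i(y)-\sum_i r_is_i(y')|\le\lambda\|s(y)-s(y')\|_\infty$ for all $y,y'\in\mathcal{Y}$. Assume that $\mathcal{P}_s=\{s(y):y\in\mathcal{Y}\}$ is convex. **Algorithm.**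 (1) Choose for every $\ell\in\mathcal{L}$ a loss $\hat\ell(a,v)=r_0(a)+\sum_i r_i(a)v_i$ that is $\lambda$-Lipschitz in $v\in[0,1]^n$ (sup norm) and satisfies $|\hat\ell(a,s(y))-\ell(a,y)|\le\delta$ for all $a$ and $y$, and round all coefficients to the nearest multiple of $\gamma$; call the resulting family $\hat{\mathcal{L}}_\gamma$. (2) Let $\mathcal{E}$ consist of the functions $(x,p)\mapsto q^{\ell}(a,p)$ and $(x,p)\mapsto q^{\ell}(a,p)\mathbf{1}[c(x)=b]$ for $\ell\in\hat{\mathcal{L}}_\gamma$, $a,b\in\mathcal{A}$, $c\in\mathcal{C}$. In round $t=1,\dots,T$, given $x_1,\dots,x_t$ and $s(y_1),\dots,s(y_{t-1})$, a weight rule turns the past values $\mathbb{E}_{p\sim\pi_r}[\sigma E(x_r,p)(p^i-s_i(y_r))]$, $r<t$, of all triples $(E,i,\sigma)\in\mathcal{E}\times[n]\times\{\pm1\}$ into a probability distribution $q_t$ on the triples, and $\pi_t$ is a solution of $$\min_{\pi\in\Delta\mathcal{P}_s}\ \max_{v\in\mathcal{P}_s}\ \mathbb{E}_{p\sim\pi}\Big[\sum_{E,i,\sigma}q_t(E,i,\sigma)\,\sigma\,E(x_t,p)\,(p^i-v^i)\Big]$$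 (max read as sup) up to an additive tolerance $\tau\ge0$. (3) Draw $\hat p_t\sim\pi_t$ and broadcast any preimage $p_t\in s^{-1}(\hat p_t)$ (possibly random; the losses and the $s_i$ are assumed to be almost everywhere measurable for the law of $p_t$). **Theorem.** There is a universal constant $K$ such that the following holds in every such setting. A family $\hat{\mathcal{L}}_\gamma$ as in (1) exists and is finite. For each such family there is a weight rule such that, for every $\tau\in[0,\frac1{|\mathcal{A}|T}]$, the algorithm can be carried out (if $\tau=0$, this is asserted for closed $\mathcal{P}_s$), and however it is carried out, for all sequences of contexts $x_1,\dots,x_T$ and outcomes $y_1,\dots,y_T\in\mathcal{Y}$, all $\ell\in\mathcal{L}$ and all assignments of policies $\{c_a\in\mathcal{C}\}_{a\in\mathcal{A}}$, $$\frac1T\sum_{t=1}^T\mathbb{E}_{p_t}\,\mathbb{E}_{a\sim q^\ell(\cdot,p_t)}\big[\ell(a,y_t)-\ell(c_a(x_t),y_t)\big]\le\varepsilon,$$ that is, agents who play the smooth best response $q^\ell(p_t)$ to the broadcast predictions have $(\mathcal{L},\mathcal{C},\varepsilon)$-decision swap regret in expectation over the predictions, where $$\varepsilon=\frac{\ln|\mathcal{A}|+1}{\eta}+K\lambda|\mathcal{A}|\sqrt{\frac{n|\mathcal{A}|\ln\big(n(\lambda/\gamma)|\mathcal{A}||\mathcal{C}|T\big)}{T}}+2\delta+2n\gamma+|\mathcal{A}|\big(e^{2\eta(\delta+n\gamma)}-1\big)$$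 (the square root is read as $0$ where the logarithm is negative or undefined). -/

import Mathlib

open MeasureTheory

noncomputable section

namespace DecisionSwap

/-- The outcome space `[0,1]^d`. -/
abbrev Cube (d : ℕ) : Type := Fin d → unitInterval

/-- A (bounded) loss function `ℓ : A × [0,1]^d → [0,1]`. -/
abbrev Loss (A : Type*) (d : ℕ) : Type _ := A → Cube d → unitInterval

/-- The basis vector `s(y) = (s₁(y), …, sₙ(y))`, as a vector of `ℝⁿ` (which carries the sup norm). -/
def basisVec {d n : ℕ} (s : Fin n → Cube d → unitInterval) (y : Cube d) : Fin n → ℝ :=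
  fun i => (s i y : ℝ)

/-- The image `{s(y) : y ∈ [0,1]^d}` of the basis. -/
def basisImage {d n : ℕ} (s : Fin n → Cube d → unitInterval) : Set (Fin n → ℝ) :=
  Set.range (basisVec s)

/-- `s` is an `(n, lam, δ)`-approximate basis for the function family `F`: every `f ∈ F` is within
`δ` of some `r₀ + ∑ rᵢ sᵢ(y)` which is `lam`-Lipschitz in `s(y)` for the sup norm. -/
def IsApproxBasis {d n : ℕ} (s : Fin n → Cube d → unitInterval) (lam δ : ℝ)
    (F : Set (Cube d → ℝ)) : Prop :=
  ∀ f ∈ F, ∃ (r₀ : ℝ) (r : Fin n → ℝ),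
    (∀ y, |r₀ + ∑ i, r i * (s i y : ℝ) - f y| ≤ δ) ∧
    ∀ y y', |∑ i, r i * (s i y : ℝ) - ∑ i, r i * (s i y' : ℝ)|
      ≤ lam * ‖basisVec s y - basisVec s y'‖

/-- The function family `{ℓ(a, ·) : ℓ ∈ L, a ∈ A}` attached to a family of losses. -/
def lossFunctions {A : Type*} {d : ℕ} (L : Set (Loss A d)) : Set (Cube d → ℝ) :=
  {f | ∃ ℓ ∈ L, ∃ a, f = fun y => (ℓ a y : ℝ)}

/-- Smooth (quantal) best response with smoothness parameter `η`: the weight `q^ℓ(a, p)`, which is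
proportional to `exp (-η ℓ(a, p))`. -/
def quantal {A P : Type*} [Fintype A] (η : ℝ) (ℓ : A → P → ℝ) (p : P) (a : A) : ℝ :=
  Real.exp (-η * ℓ a p) / ∑ a', Real.exp (-η * ℓ a' p)

/-! ### The linear losses and their discretization -/

/-- Coefficients of a loss on `ℝⁿ` that is linear, up to the constant term `r₀`, in the outcome. -/
structure LinLoss (A : Type*) (n : ℕ) where
  const : A → ℝ
  coeff : A → Fin n → ℝ

/-- The value `r₀(a) + ∑ rᵢ(a) vᵢ`. -/
def LinLoss.eval {A : Type*} {n : ℕ} (g : LinLoss A n) (a : A) (v : Fin n → ℝ) : ℝ :=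
  g.const a + ∑ i, g.coeff a i * v i

/-- `g` is a linear approximation of `ℓ` given by the basis `s`: it is `lam`-Lipschitz on `[0,1]^n`
in the sup norm, and `g(a, s(y))` is within `δ` of `ℓ(a, y)`. -/
def IsLinearApprox {A : Type*} {d n : ℕ} (s : Fin n → Cube d → unitInterval) (lam δ : ℝ)
    (ℓ : Loss A d) (g : LinLoss A n) : Prop :=
  (∀ a y, |g.eval a (basisVec s y) - (ℓ a y : ℝ)| ≤ δ) ∧
  ∀ a, ∀ u ∈ Set.Icc (0 : Fin n → ℝ) 1, ∀ v ∈ Set.Icc (0 : Fin n → ℝ) 1,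
    |g.eval a u - g.eval a v| ≤ lam * ‖u - v‖

/-- Rounding of every coefficient to the nearest multiple of `γ`. -/
def LinLoss.snap {A : Type*} {n : ℕ} (γ : ℝ) (g : LinLoss A n) : LinLoss A n where
  const := fun a => (round (g.const a / γ) : ℝ) * γ
  coeff := fun a i => (round (g.coeff a i / γ) : ℝ) * γ

/-- `Lγ` is a discretized family of linear losses for `L`: choose a linear approximation of every
`ℓ ∈ L`, and round its coefficients. -/
def IsDiscretizedFamily {A : Type*} {d n : ℕ} (s : Fin n → Cube d → unitInterval) (lam δ γ : ℝ)
    (L : Set (Loss A d)) (Lγ : Finset (LinLoss A n)) : Prop :=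
  ∃ rep : Loss A d → LinLoss A n, (∀ ℓ ∈ L, IsLinearApprox s lam δ ℓ (rep ℓ)) ∧
    (Lγ : Set (LinLoss A n)) = (fun ℓ => (rep ℓ).snap γ) '' L

/-! ### Unbiased prediction for the smooth best response events -/

section Algorithm

variable {X A : Type*} [Fintype A] {n : ℕ}

/-- The events conditional on which predictions are to be unbiased: one event for every `(ℓ, a)`
and one for every `(ℓ, a, b, c)`, with `ℓ` a loss of the family, `a, b` actions, `c` a policy. -/
abbrev Event (Lγ : Finset (LinLoss A n)) (C : Finset (X → A)) : Type _ :=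
  (Lγ × A) ⊕ (Lγ × A × A × C)

open scoped Classical in
/-- The value at `(x, p)`: `q^ℓ(a, p)` and `q^ℓ(a, p) 1[c(x) = b]` respectively. -/
def Event.val {Lγ : Finset (LinLoss A n)} {C : Finset (X → A)} (η : ℝ) (E : Event Lγ C)
    (x : X) (p : Fin n → ℝ) : ℝ :=
  match E with
  | .inl (ℓ, a) => quantal η ℓ.1.eval p a
  | .inr (ℓ, a, b, c) => quantal η ℓ.1.eval p a * (if c.1 x = b then 1 else 0)

/-- The triples (event, coordinate, sign). -/
abbrev Expert (Lγ : Finset (LinLoss A n)) (C : Finset (X → A)) : Type _ :=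
  Event Lγ C × Fin n × Bool

/-- `σ E(x, p) (pᵢ - vᵢ)`, the signed conditional bias of prediction `p` on outcome `v`. -/
def bias {Lγ : Finset (LinLoss A n)} {C : Finset (X → A)} (η : ℝ) (j : Expert Lγ C)
    (x : X) (p v : Fin n → ℝ) : ℝ :=
  (if j.2.2 then 1 else -1) * j.1.val η x p * (p j.2.1 - v j.2.1)

/-- `E_{p ∼ π} [∑_j w_j · bias_j]` for a vector `w` of weights on the triples. -/
def objective {Lγ : Finset (LinLoss A n)} {C : Finset (X → A)} (η : ℝ) (w : Expert Lγ C → ℝ)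
    (x : X) (π : Measure (Fin n → ℝ)) (v : Fin n → ℝ) : ℝ :=
  ∫ p, ∑ j, w j * bias η j x p v ∂π

/-- The value of the inner maximum, over outcomes `v ∈ K`, of the min-max problem. -/
def worstCase {Lγ : Finset (LinLoss A n)} {C : Finset (X → A)} (η : ℝ) (K : Set (Fin n → ℝ))
    (w : Expert Lγ C → ℝ) (x : X) (π : Measure (Fin n → ℝ)) : ℝ :=
  sSup (objective η w x π '' K)

/-- `π` is a probability distribution over the prediction space `K`. -/
def IsDistributionOn (K : Set (Fin n → ℝ)) (π : Measure (Fin n → ℝ)) : Prop :=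
  IsProbabilityMeasure π ∧ ∀ᵐ p ∂π, p ∈ K

/-- An online forecaster: the data are the past contexts and (transformed) outcomes, the most
recent first, and the current context; the result is a distribution `π_t`. -/
abbrev Forecaster (X : Type*) (n : ℕ) (P : Type*) [MeasurableSpace P] : Type _ :=
  List (X × (Fin n → ℝ)) → X → Measure P

/-- The expected biases `E_{p_r ∼ π_r} [σ E(x_r, p_r) (p_r - v_r)_i]` in the past rounds `r`. -/
def pastBias {Lγ : Finset (LinLoss A n)} {C : Finset (X → A)} (η : ℝ)
    (F : Forecaster X n (Fin n → ℝ)) : List (X × (Fin n → ℝ)) → List (Expert Lγ C → ℝ)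
  | [] => []
  | (x, v) :: h => (fun j => ∫ p, bias η j x p v ∂(F h x)) :: pastBias η F h

/-- A rule that turns the past expected biases of the triples into a probability distribution `q_t`
over the triples. -/
def IsWeightRule {Lγ : Finset (LinLoss A n)} {C : Finset (X → A)}
    (W : List (Expert Lγ C → ℝ) → Expert Lγ C → ℝ) : Prop :=
  ∀ h, W h ∈ stdSimplex ℝ (Expert Lγ C)

/-- `F` is the unbiased prediction algorithm with weight rule `W` on the prediction and outcome
space `K`: in every round, with `q_t` the weights, `π_t` solves
`min_{π ∈ Δ K} max_{v ∈ K} E_{p ∼ π} [∑ q_t(E, i, σ) σ E(x_t, p) (pᵢ - vᵢ)]`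
up to an additive tolerance `tol` (`tol = 0` is an exact minimizer). -/
def IsUnbiasedPrediction {Lγ : Finset (LinLoss A n)} {C : Finset (X → A)} (η tol : ℝ)
    (K : Set (Fin n → ℝ)) (W : List (Expert Lγ C → ℝ) → Expert Lγ C → ℝ)
    (F : Forecaster X n (Fin n → ℝ)) : Prop :=
  ∀ h : List (X × (Fin n → ℝ)), (∀ r ∈ h, r.2 ∈ K) → ∀ x,
    IsDistributionOn K (F h x) ∧
    ∀ π', IsDistributionOn K π' →
      worstCase η K (W (pastBias η F h)) x (F h x)
        ≤ worstCase η K (W (pastBias η F h)) x π' + tol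

/-- `B` broadcasts preimages of the predictions of `F`: `B h x` is the law of a random
`p_t ∈ [0,1]^d` such that `s(p_t)` has the law `F h x`. Only laws for which the losses of the family
`L` and the basis functions are (almost everywhere) measurable are considered, so that the
expectations are meaningful; every finitely supported law is such. -/
def IsPreimageBroadcast {d : ℕ} (s : Fin n → Cube d → unitInterval) (L : Set (Loss A d))
    (F : Forecaster X n (Fin n → ℝ)) (B : Forecaster X n (Cube d)) : Prop :=
  ∀ h : List (X × (Fin n → ℝ)), (∀ r ∈ h, r.2 ∈ basisImage s) → ∀ x,
    IsProbabilityMeasure (B h x) ∧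
    AEMeasurable (basisVec s) (B h x) ∧
    (B h x).map (basisVec s) = F h x ∧
    ∀ ℓ ∈ L, ∀ a, AEMeasurable (fun p => (ℓ a p : ℝ)) (B h x)

/-- `B` is an implementation of the whole algorithm: it runs unbiased prediction on the basis image,
for the smooth best response events of the discretized losses, and broadcasts preimages. -/
def IsSmoothDecisionSwap {d : ℕ} (s : Fin n → Cube d → unitInterval) (L : Set (Loss A d))
    {Lγ : Finset (LinLoss A n)} {C : Finset (X → A)} (η tol : ℝ)
    (W : List (Expert Lγ C → ℝ) → Expert Lγ C → ℝ) (B : Forecaster X n (Cube d)) : Prop :=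
  ∃ F : Forecaster X n (Fin n → ℝ),
    IsUnbiasedPrediction η tol (basisImage s) W F ∧ IsPreimageBroadcast s L F B

end Algorithm

/-! ### Decision swap regret -/

/-- The history before round `t` (rounds are numbered from `0`), most recent round first. -/
def history {X V : Type*} (x : ℕ → X) (v : ℕ → V) : ℕ → List (X × V)
  | 0 => []
  | t + 1 => (x t, v t) :: history x v t

/-- The random predictions `p_t ∼ μ_t`, `t < T`, have `(L, C, ε)`-decision swap regret, in
expectation, for the contexts `x` and outcomes `y`, when an agent with loss `ℓ` plays the
distribution `k ℓ p_t` over actions: against every assignment of policies `c_a ∈ C`,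
`(1/T) ∑_t E_{p_t ∼ μ_t} E_{a ∼ k ℓ p_t} [ℓ(a, y_t) - ℓ(c_a(x_t), y_t)] ≤ ε`. -/
def HasDecisionSwapRegret {X A : Type*} [Fintype A] {d : ℕ} (L : Set (Loss A d))
    (C : Finset (X → A)) (ε : ℝ) (k : Loss A d → Cube d → A → ℝ) (T : ℕ)
    (x : ℕ → X) (y : ℕ → Cube d) (μ : ℕ → Measure (Cube d)) : Prop :=
  ∀ ℓ ∈ L, ∀ c : A → X → A, (∀ a, c a ∈ C) →
    (1 / (T : ℝ)) * ∑ t ∈ Finset.range T,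
      ∫ p, ∑ a, k ℓ p a * ((ℓ a (y t) : ℝ) - (ℓ (c a (x t)) (y t) : ℝ)) ∂(μ t) ≤ ε

end DecisionSwap

end

open MeasureTheory

noncomputable section

namespace DecisionSwap

theorem exp_sub_sq_le {x : ℝ} (hx : |x| ≤ 1 / 2) : Real.exp (x - x ^ 2) ≤ 1 + x := by
  obtain ⟨h1, h2⟩ := abs_le.1 hx
  -- For `x ≥ 0` the linear lower bound of `exp` suffices, because `(1 + x)(1 + x² - x) = 1 + x³`.
  -- For `x < 0` this falls below `1`, and the quadratic term is needed.
  have key : 1 ≤ (1 + x) * Real.exp (x ^ 2 - x) := by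
    rcases le_or_gt 0 x with h | h
    · have := Real.add_one_le_exp (x ^ 2 - x)
      have h3 : 0 ≤ x ^ 3 := by positivity
      nlinarith [mul_le_mul_of_nonneg_left this (by linarith : 0 ≤ 1 + x)]
    · have h0 : 0 ≤ x ^ 2 - x := by nlinarith [sq_nonneg x]
      have := Real.quadratic_le_exp_of_nonneg h0
      have h3 := mul_le_mul_of_nonneg_left this (by linarith : 0 ≤ 1 + x)
      have h4 : 0 ≤ x ^ 2 * (x ^ 3 - x ^ 2 + x + 1) := by
        have : -(1 / 8) ≤ x ^ 3 := by nlinarith [sq_nonneg x, sq_nonneg (x + 1 / 2)]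
        have : x ^ 2 ≤ 1 / 4 := by nlinarith
        apply mul_nonneg (sq_nonneg x); linarith
      nlinarith
  have hmul : Real.exp (x - x ^ 2) * Real.exp (x ^ 2 - x) = 1 := by
    rw [← Real.exp_add]; simp
  have hpos := Real.exp_pos (x - x ^ 2)
  nlinarith [mul_le_mul_of_nonneg_left key hpos.le]

/-! ### Stability and near-optimality of smooth best responses. -/

section Quantal

variable {A P : Type*} [Fintype A] {η : ℝ}

theorem quantal_denom_pos [Nonempty A] (ℓ : A → P → ℝ) (p : P) :
    0 < ∑ a, Real.exp (-η * ℓ a p) :=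
  Finset.sum_pos (fun _ _ => Real.exp_pos _) Finset.univ_nonempty

theorem quantal_nonneg (ℓ : A → P → ℝ) (p : P) (a : A) : 0 ≤ quantal η ℓ p a :=
  div_nonneg (Real.exp_pos _).le (Finset.sum_nonneg fun _ _ => (Real.exp_pos _).le)

theorem sum_quantal [Nonempty A] (ℓ : A → P → ℝ) (p : P) : ∑ a, quantal η ℓ p a = 1 := by
  simp only [quantal]
  rw [← Finset.sum_div, div_self (quantal_denom_pos ℓ p).ne']

theorem quantal_le_one [Nonempty A] (ℓ : A → P → ℝ) (p : P) (a : A) : quantal η ℓ p a ≤ 1 := by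
  rw [← sum_quantal (η := η) ℓ p]
  exact Finset.single_le_sum (fun b _ => quantal_nonneg ℓ p b) (Finset.mem_univ a)

/-- If the losses are within `δ`, then the smooth best responses differ by at most a factor
`exp (2ηδ)`. -/
theorem quantal_le_exp_mul [Nonempty A] {Q : Type*} (hη : 0 ≤ η) {ℓ : A → P → ℝ} {g : A → Q → ℝ}
    {p : P} {u : Q} {δ : ℝ} (h : ∀ a, |ℓ a p - g a u| ≤ δ) (a : A) :
    quantal η ℓ p a ≤ Real.exp (2 * η * δ) * quantal η g u a := by
  have hg := quantal_denom_pos (η := η) g u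
  have hℓ := quantal_denom_pos (η := η) ℓ p
  have h1 : Real.exp (-η * ℓ a p) ≤ Real.exp (η * δ) * Real.exp (-η * g a u) := by
    rw [← Real.exp_add]
    apply Real.exp_le_exp.2
    have := (abs_le.1 (h a)).1
    nlinarith
  have h2 : ∑ b, Real.exp (-η * g b u) ≤ Real.exp (η * δ) * ∑ b, Real.exp (-η * ℓ b p) := by
    rw [Finset.mul_sum]
    refine Finset.sum_le_sum fun b _ => ?_
    rw [← Real.exp_add]
    apply Real.exp_le_exp.2
    have := (abs_le.1 (h b)).2
    nlinarith
  have h3 : Real.exp (2 * η * δ) = Real.exp (η * δ) * Real.exp (η * δ) := by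
    rw [← Real.exp_add]; ring_nf
  unfold quantal
  rw [← mul_div_assoc, div_le_div_iff₀ hℓ hg, h3]
  calc _ ≤ (Real.exp (η * δ) * Real.exp (-η * g a u)) *
        (Real.exp (η * δ) * ∑ b, Real.exp (-η * ℓ b p)) :=
        mul_le_mul h1 h2 hg.le (by positivity)
    _ = _ := by ring

/-- The two-sided ratio bound makes each weight change by a relative amount of at most `exp (2ηδ) -
1`, and the weights sum to `1`. -/
theorem sum_abs_quantal_sub_le [Nonempty A] {Q : Type*} (hη : 0 ≤ η) {ℓ : A → P → ℝ}
    {g : A → Q → ℝ} {p : P} {u : Q} {δ : ℝ} (h : ∀ a, |ℓ a p - g a u| ≤ δ) :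
    ∑ a, |quantal η ℓ p a - quantal η g u a| ≤ Real.exp (2 * η * δ) - 1 := by
  have hδ : 0 ≤ δ := (abs_nonneg _).trans (h (Classical.arbitrary A))
  have hE : 1 ≤ Real.exp (2 * η * δ) := Real.one_le_exp (by positivity)
  have hc : ∀ a, |quantal η ℓ p a - quantal η g u a|
      ≤ (Real.exp (2 * η * δ) - 1) * quantal η g u a := by
    intro a
    have h1 := quantal_le_exp_mul hη h a
    have h2 := quantal_le_exp_mul hη (ℓ := g) (g := ℓ) (p := u) (u := p)
      (fun a => by rw [abs_sub_comm]; exact h a) a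
    have hq := quantal_nonneg (η := η) ℓ p a
    have hq' := quantal_nonneg (η := η) g u a
    rw [abs_le]
    refine ⟨?_, by linarith⟩
    -- With `E = exp (2ηδ)`, the negation gives `q' ≤ E q < E (2 - E) q' = (1 - (E - 1)²) q'`.
    by_contra hcon
    push Not at hcon
    nlinarith [mul_nonneg (sub_nonneg.2 hE) (sub_nonneg.2 hE)]
  calc _ ≤ ∑ a, (Real.exp (2 * η * δ) - 1) * quantal η g u a := Finset.sum_le_sum fun a _ => hc a
    _ = _ := by rw [← Finset.mul_sum, sum_quantal, mul_one]

/-- The smooth best response is optimal up to `log |A| / η`. -/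
theorem sum_quantal_mul_le [Nonempty A] (hη : 0 < η) (ℓ : A → P → ℝ) (p : P) (b : A) :
    ∑ a, quantal η ℓ p a * (ℓ a p - ℓ b p) ≤ Real.log (Fintype.card A) / η := by
  have hZ := quantal_denom_pos (η := η) ℓ p
  set Z := ∑ a, Real.exp (-η * ℓ a p) with hZdef
  have hN : (0 : ℝ) < Fintype.card A := by exact_mod_cast Fintype.card_pos
  have hq : ∀ a, 0 < quantal η ℓ p a := fun a => div_pos (Real.exp_pos _) hZ
  have hlogq : ∀ a, Real.log (quantal η ℓ p a) = -η * ℓ a p - Real.log Z := fun a => by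
    rw [quantal, Real.log_div (Real.exp_pos _).ne' hZ.ne', Real.log_exp]
  -- Entropy is at most `log |A|`, from `log x ≤ x - 1` at `x = 1 / (|A| q)`.
  have hent : ∑ a, quantal η ℓ p a * -Real.log (quantal η ℓ p a)
      ≤ Real.log (Fintype.card A) := by
    have hc : ∀ a, quantal η ℓ p a * -Real.log (quantal η ℓ p a)
        ≤ quantal η ℓ p a * Real.log (Fintype.card A) + (1 / Fintype.card A - quantal η ℓ p a) := by
      intro a
      have h1 := Real.log_le_sub_one_of_pos (x := 1 / (Fintype.card A * quantal η ℓ p a))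
        (by have := hq a; positivity)
      rw [Real.log_div one_ne_zero (by have := hq a; positivity), Real.log_one,
        Real.log_mul hN.ne' (hq a).ne'] at h1
      have h2 := mul_le_mul_of_nonneg_left h1 (hq a).le
      have h3 : quantal η ℓ p a * (1 / (Fintype.card A * quantal η ℓ p a) - 1)
          = 1 / Fintype.card A - quantal η ℓ p a := by
        have := (hq a).ne'; field_simp
      rw [h3] at h2
      linarith
    refine (Finset.sum_le_sum fun a _ => hc a).trans_eq ?_
    rw [Finset.sum_add_distrib, ← Finset.sum_mul, sum_quantal, Finset.sum_sub_distrib, sum_quantal]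
    simp [hN.ne']
  have hb : -η * ℓ b p ≤ Real.log Z := by
    rw [← Real.log_exp (-η * ℓ b p)]
    exact Real.log_le_log (Real.exp_pos _)
      (Finset.single_le_sum (f := fun a => Real.exp (-η * ℓ a p))
        (fun _ _ => (Real.exp_pos _).le) (Finset.mem_univ b))
  rw [le_div_iff₀ hη]
  calc _ = ∑ a, quantal η ℓ p a * (-Real.log (quantal η ℓ p a)) +
        ∑ a, quantal η ℓ p a * (-Real.log Z - η * ℓ b p) := by
        rw [← Finset.sum_add_distrib, Finset.sum_mul]
        refine Finset.sum_congr rfl fun a _ => ?_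
        rw [hlogq]; ring
    _ ≤ _ := by
        rw [← Finset.sum_mul, sum_quantal]; linarith

/-- Two normalized families of weights are close if the weights are. -/
theorem sum_abs_div_sub_div_le [Nonempty A] {u w : A → ℝ} (hu : ∀ a, 0 < u a) (hw : ∀ a, 0 < w a) :
    ∑ a, |u a / ∑ b, u b - w a / ∑ b, w b| ≤ 2 * (∑ a, |u a - w a|) / ∑ b, u b := by
  have hU : 0 < ∑ b, u b := Finset.sum_pos (fun a _ => hu a) Finset.univ_nonempty
  have hW : 0 < ∑ b, w b := Finset.sum_pos (fun a _ => hw a) Finset.univ_nonempty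
  set U := ∑ b, u b with hUd
  set W := ∑ b, w b with hWd
  have hWU : |W - U| ≤ ∑ a, |u a - w a| := by
    rw [hUd, hWd, abs_sub_comm, ← Finset.sum_sub_distrib]
    exact Finset.abs_sum_le_sum_abs _ _
  have hc : ∀ a, |u a / U - w a / W| ≤ |u a - w a| / U + w a / W * (|W - U| / U) := by
    intro a
    have : u a / U - w a / W = (u a - w a) / U + w a / W * ((W - U) / U) := by
      field_simp; ring
    rw [this]
    refine (abs_add_le _ _).trans_eq ?_
    rw [abs_div, abs_mul, abs_div, abs_div, abs_of_pos hU, abs_of_pos hW, abs_of_pos (hw a)]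
  calc _ ≤ ∑ a, (|u a - w a| / U + w a / W * (|W - U| / U)) := Finset.sum_le_sum fun a _ => hc a
    _ = (∑ a, |u a - w a|) / U + |W - U| / U := by
        rw [Finset.sum_add_distrib, ← Finset.sum_div, ← Finset.sum_mul, ← Finset.sum_div,
          div_self hW.ne', one_mul]
    _ ≤ _ := by
        rw [← add_div]; gcongr; linarith

/-- Smooth best responses do not depend much on the offsets of actions which are far from
optimal. -/
theorem sum_abs_quantal_sub_le_of_offset [Nonempty A] (hη : 0 ≤ η) {g h : A → P → ℝ} {p : P}
    {f og oh : A → ℝ} {kg kh R G : ℝ} (hg : ∀ a, g a p = kg + og a + f a)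
    (hh : ∀ a, h a p = kh + oh a + f a) (hf : ∀ a, |f a| ≤ R) (hog : ∃ b, og b = 0)
    (ho : ∀ a, og a = oh a ∨ (G ≤ og a ∧ G ≤ oh a)) :
    ∑ a, |quantal η g p a - quantal η h p a|
      ≤ 2 * Fintype.card A * Real.exp (-η * (G - 2 * R)) := by
  -- The common constant `k` cancels between numerator and denominator.
  have shift : ∀ (k : ℝ) (o : A → ℝ) (m : A → P → ℝ), (∀ a, m a p = k + o a + f a) → ∀ a,
      quantal η m p a
        = Real.exp (-η * (o a + f a)) / ∑ b, Real.exp (-η * (o b + f b)) := by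
    intro k o m hm a
    have : ∀ b, Real.exp (-η * m b p) = Real.exp (-η * k) * Real.exp (-η * (o b + f b)) := by
      intro b; rw [← Real.exp_add, hm]; ring_nf
    simp only [quantal, this, ← Finset.mul_sum]
    rw [mul_div_mul_left _ _ (Real.exp_pos _).ne']
  simp only [shift kg og g hg, shift kh oh h hh]
  refine (sum_abs_div_sub_div_le (fun a => Real.exp_pos _) (fun a => Real.exp_pos _)).trans ?_
  obtain ⟨b, hb⟩ := hog
  -- The action with zero offset keeps the denominator away from `0`; only actions with offsets at
  -- least `G` contribute to the difference of the numerators.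
  have hden : Real.exp (-η * R) ≤ ∑ b, Real.exp (-η * (og b + f b)) := by
    refine le_trans ?_ (Finset.single_le_sum (f := fun a => Real.exp (-η * (og a + f a)))
        (fun _ _ => (Real.exp_pos _).le) (Finset.mem_univ b))
    apply Real.exp_le_exp.2
    have := (abs_le.1 (hf b)).2
    rw [hb]; nlinarith
  have hnum : ∑ a, |Real.exp (-η * (og a + f a)) - Real.exp (-η * (oh a + f a))|
      ≤ Fintype.card A * Real.exp (-η * (G - R)) := by
    have : ∀ a, |Real.exp (-η * (og a + f a)) - Real.exp (-η * (oh a + f a))|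
        ≤ Real.exp (-η * (G - R)) := by
      intro a
      rcases ho a with h | ⟨h1, h2⟩
      · rw [h]; simp [(Real.exp_pos _).le]
      · have hfa := (abs_le.1 (hf a)).1
        have e1 : Real.exp (-η * (og a + f a)) ≤ Real.exp (-η * (G - R)) :=
          Real.exp_le_exp.2 (by nlinarith)
        have e2 : Real.exp (-η * (oh a + f a)) ≤ Real.exp (-η * (G - R)) :=
          Real.exp_le_exp.2 (by nlinarith)
        have p1 := Real.exp_pos (-η * (og a + f a))
        have p2 := Real.exp_pos (-η * (oh a + f a))
        rw [abs_le]; constructor <;> linarith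
    refine (Finset.sum_le_sum fun a _ => this a).trans_eq ?_
    simp
  rw [div_le_iff₀ (lt_of_lt_of_le (Real.exp_pos _) hden)]
  calc _ ≤ 2 * (Fintype.card A * Real.exp (-η * (G - R))) := by gcongr
    _ = 2 * Fintype.card A * Real.exp (-η * (G - 2 * R)) * Real.exp (-η * R) := by
        have : Real.exp (-η * (G - R)) = Real.exp (-η * (G - 2 * R)) * Real.exp (-η * R) := by
          rw [← Real.exp_add]; ring_nf
        rw [this]; ring
    _ ≤ _ := by gcongr

end Quantal

/-! ### Linear approximations of losses and their rounding. -/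

section Linear

variable {A : Type*} {d n : ℕ} {s : Fin n → Cube d → unitInterval} {lam δ γ : ℝ}

theorem basisVec_mem_Icc (s : Fin n → Cube d → unitInterval) (y : Cube d) :
    basisVec s y ∈ Set.Icc (0 : Fin n → ℝ) 1 :=
  ⟨fun i => (s i y).2.1, fun i => (s i y).2.2⟩

theorem basisImage_subset_Icc (s : Fin n → Cube d → unitInterval) :
    basisImage s ⊆ Set.Icc (0 : Fin n → ℝ) 1 := by
  rintro _ ⟨y, rfl⟩; exact basisVec_mem_Icc s y

theorem abs_sub_le_one_of_mem_Icc {u v : Fin n → ℝ} (hu : u ∈ Set.Icc (0 : Fin n → ℝ) 1)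
    (hv : v ∈ Set.Icc (0 : Fin n → ℝ) 1) (i : Fin n) : |u i - v i| ≤ 1 := by
  have h1 := hu.1 i; have h2 := hu.2 i; have h3 := hv.1 i; have h4 := hv.2 i
  simp only [Pi.zero_apply, Pi.one_apply] at h1 h2 h3 h4
  rw [abs_le]; constructor <;> linarith

theorem norm_sub_le_one_of_mem_Icc {u v : Fin n → ℝ} (hu : u ∈ Set.Icc (0 : Fin n → ℝ) 1)
    (hv : v ∈ Set.Icc (0 : Fin n → ℝ) 1) : ‖u - v‖ ≤ 1 :=
  (pi_norm_le_iff_of_nonneg zero_le_one).2 fun i => abs_sub_le_one_of_mem_Icc hu hv i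

/-- The dual of the sup norm is the ℓ¹ norm: compare the values at two opposite vertices of the
cube, chosen by the signs of the coefficients. -/
theorem IsLinearApprox.sum_abs_coeff_le {ℓ : Loss A d} {g : LinLoss A n}
    (h : IsLinearApprox s lam δ ℓ g) (hlam : 0 ≤ lam) (a : A) : ∑ i, |g.coeff a i| ≤ lam := by
  set u : Fin n → ℝ := fun i => if 0 ≤ g.coeff a i then 1 else 0 with hu
  set v : Fin n → ℝ := fun i => if 0 ≤ g.coeff a i then 0 else 1 with hv
  have hu' : u ∈ Set.Icc (0 : Fin n → ℝ) 1 := by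
    constructor <;> intro i <;> simp only [hu, Pi.zero_apply, Pi.one_apply] <;> split_ifs <;> simp
  have hv' : v ∈ Set.Icc (0 : Fin n → ℝ) 1 := by
    constructor <;> intro i <;> simp only [hv, Pi.zero_apply, Pi.one_apply] <;> split_ifs <;> simp
  have h1 := (le_abs_self _).trans (h.2 a u hu' v hv')
  have h2 : g.eval a u - g.eval a v = ∑ i, |g.coeff a i| := by
    simp only [LinLoss.eval, add_sub_add_left_eq_sub, ← Finset.sum_sub_distrib]
    refine Finset.sum_congr rfl fun i _ => ?_
    by_cases hi : 0 ≤ g.coeff a i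
    · simp [hu, hv, hi, abs_of_nonneg hi]
    · simp [hu, hv, hi, abs_of_neg (not_le.1 hi)]
  rw [h2] at h1
  exact h1.trans (mul_le_of_le_one_right hlam (norm_sub_le_one_of_mem_Icc hu' hv'))

theorem abs_round_mul_sub_le (hγ : 0 < γ) (r : ℝ) : |(round (r / γ) : ℝ) * γ - r| ≤ γ / 2 := by
  have h := abs_sub_round (r / γ)
  have : (round (r / γ) : ℝ) * γ - r = -((r / γ - round (r / γ)) * γ) := by field_simp; ring
  rw [this, abs_neg, abs_mul, abs_of_pos hγ]
  nlinarith

theorem abs_snap_eval_sub_le (hγ : 0 < γ) (g : LinLoss A n) (a : A) {u : Fin n → ℝ}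
    (hu : u ∈ Set.Icc (0 : Fin n → ℝ) 1) :
    |(g.snap γ).eval a u - g.eval a u| ≤ (n + 1) * γ / 2 := by
  have h : (g.snap γ).eval a u - g.eval a u = ((round (g.const a / γ) : ℝ) * γ - g.const a) +
      ∑ i, ((round (g.coeff a i / γ) : ℝ) * γ - g.coeff a i) * u i := by
    simp only [LinLoss.eval, LinLoss.snap, sub_mul, Finset.sum_sub_distrib]; ring
  rw [h]
  refine (abs_add_le _ _).trans ?_
  have h1 : |∑ i, ((round (g.coeff a i / γ) : ℝ) * γ - g.coeff a i) * u i| ≤ n * (γ / 2) := by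
    refine (Finset.abs_sum_le_sum_abs _ _).trans ?_
    refine (Finset.sum_le_sum fun i _ => (?_ : _ ≤ γ / 2)).trans_eq (by simp)
    rw [abs_mul]
    have h0 := hu.1 i; have h1 := hu.2 i
    simp only [Pi.zero_apply, Pi.one_apply] at h0 h1
    rw [abs_of_nonneg h0]
    exact (mul_le_of_le_one_right (abs_nonneg _) h1).trans (abs_round_mul_sub_le hγ _)
  have := abs_round_mul_sub_le hγ (g.const a)
  linarith

theorem sum_abs_snap_coeff_le (hγ : 0 < γ) (g : LinLoss A n) (a : A) :
    ∑ i, |(g.snap γ).coeff a i| ≤ ∑ i, |g.coeff a i| + n * (γ / 2) := by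
  have : ∀ i, |(g.snap γ).coeff a i| ≤ |g.coeff a i| + γ / 2 := fun i => by
    have h := abs_round_mul_sub_le hγ (g.coeff a i)
    have h2 := abs_sub_abs_le_abs_sub ((round (g.coeff a i / γ) : ℝ) * γ) (g.coeff a i)
    simp only [LinLoss.snap]
    linarith
  refine (Finset.sum_le_sum fun i _ => this i).trans_eq ?_
  simp [Finset.sum_add_distrib]

/-- Convexity merges a sum of two scaled differences into a single one, and a negative factor swaps
the endpoints. A Lipschitz bound on `K` thus becomes a norm bound on the span of its differences. -/
theorem exists_smul_sub_of_mem_span {E : Type*} [AddCommGroup E] [Module ℝ E] {K : Set E}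
    (hK : Convex ℝ K) (hne : K.Nonempty) {w : E}
    (hw : w ∈ Submodule.span ℝ {w | ∃ u ∈ K, ∃ v ∈ K, w = u - v}) :
    ∃ t : ℝ, 0 ≤ t ∧ ∃ u ∈ K, ∃ v ∈ K, w = t • (u - v) := by
  induction hw using Submodule.span_induction with
  | mem x hx =>
    obtain ⟨u, hu, v, hv, rfl⟩ := hx
    exact ⟨1, zero_le_one, u, hu, v, hv, (one_smul _ _).symm⟩
  | zero =>
    obtain ⟨u, hu⟩ := hne
    exact ⟨0, le_rfl, u, hu, u, hu, by simp⟩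
  | add x y _ _ hx hy =>
    obtain ⟨t, ht, u, hu, v, hv, rfl⟩ := hx
    obtain ⟨t', ht', u', hu', v', hv', rfl⟩ := hy
    rcases (add_nonneg ht ht').eq_or_lt with h0 | hpos
    · have h1 : t = 0 := by linarith
      have h2 : t' = 0 := by linarith
      exact ⟨0, le_rfl, u, hu, v, hv, by rw [h1, h2]; simp only [zero_smul, add_zero]⟩
    · refine ⟨t + t', hpos.le, (t / (t + t')) • u + (t' / (t + t')) • u',
        hK hu hu' (by positivity) (by positivity) (by field_simp),
        (t / (t + t')) • v + (t' / (t + t')) • v',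
        hK hv hv' (by positivity) (by positivity) (by field_simp), ?_⟩
      have h1 : (t + t') * (t / (t + t')) = t := by field_simp
      have h2 : (t + t') * (t' / (t + t')) = t' := by field_simp
      simp only [smul_sub, smul_add, smul_smul, h1, h2]
      abel
  | smul c x _ hx =>
    obtain ⟨t, ht, u, hu, v, hv, rfl⟩ := hx
    rcases le_or_gt 0 c with hc | hc
    · exact ⟨c * t, by positivity, u, hu, v, hv, by rw [smul_smul]⟩
    · refine ⟨-c * t, by nlinarith, v, hv, u, hu, ?_⟩
      rw [smul_smul, ← neg_sub u v, smul_neg, ← neg_smul]; ring_nf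

/-- A linear functional which is Lipschitz on a convex set agrees, up to a constant, with a linear
functional which is Lipschitz everywhere. -/
theorem exists_lipschitz_extension {K : Set (Fin n → ℝ)} (hK : Convex ℝ K) (hne : K.Nonempty)
    (hlam : 0 ≤ lam) (r : Fin n → ℝ)
    (hr : ∀ u ∈ K, ∀ v ∈ K, |∑ i, r i * u i - ∑ i, r i * v i| ≤ lam * ‖u - v‖) :
    ∃ r' : Fin n → ℝ, (∀ w : Fin n → ℝ, |∑ i, r' i * w i| ≤ lam * ‖w‖) ∧
      ∀ u ∈ K, ∀ v ∈ K, ∑ i, r' i * (u i - v i) = ∑ i, r i * (u i - v i) := by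
  set p := Submodule.span ℝ {w | ∃ u ∈ K, ∃ v ∈ K, w = u - v} with hp
  let φ : (Fin n → ℝ) →ₗ[ℝ] ℝ := ∑ i, r i • LinearMap.proj i
  have hφ : ∀ w, φ w = ∑ i, r i * w i := fun w => by simp [φ, LinearMap.sum_apply]
  have hb : ∀ w : p, ‖φ.domRestrict p w‖ ≤ lam * ‖w‖ := by
    rintro ⟨w, hw⟩
    obtain ⟨t, ht, u, hu, v, hv, rfl⟩ := exists_smul_sub_of_mem_span hK hne hw
    have h := hr u hu v hv
    rw [← hφ, ← hφ] at h
    rw [LinearMap.domRestrict_apply, map_smul, map_sub, Submodule.coe_norm, norm_smul, norm_smul,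
      Real.norm_eq_abs, Real.norm_eq_abs, abs_of_nonneg ht]
    calc _ ≤ t * (lam * ‖u - v‖) := by gcongr
      _ = _ := by ring
  -- Hahn–Banach: extend from the span of the differences without increasing the norm.
  obtain ⟨g, hg, hgn⟩ := exists_extension_norm_eq p ((φ.domRestrict p).mkContinuous lam hb)
  have hgn' : ‖g‖ ≤ lam := hgn ▸ LinearMap.mkContinuous_norm_le _ hlam _
  have hgs : ∀ w : Fin n → ℝ, ∑ i, g (Pi.single i 1) * w i = g w := fun w => by
    have := LinearMap.pi_apply_eq_sum_univ (g : (Fin n → ℝ) →ₗ[ℝ] ℝ) w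
    simp only [ContinuousLinearMap.coe_coe, smul_eq_mul] at this
    rw [this]
    refine Finset.sum_congr rfl fun i _ => ?_
    rw [mul_comm]; congr 2; ext j; simp [Pi.single_apply, eq_comm]
  refine ⟨fun i => g (Pi.single i 1), fun w => ?_, fun u hu v hv => ?_⟩
  · rw [hgs]
    exact (g.le_opNorm w).trans (by gcongr)
  · have hmem : u - v ∈ p := Submodule.subset_span ⟨u, hu, v, hv, rfl⟩
    have h1 := hgs (u - v)
    have h2 := hg ⟨u - v, hmem⟩
    have h3 := hφ (u - v)
    simp only [Pi.sub_apply] at h1 h3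
    rw [h1, h2, ← h3]; rfl

/-- An approximate basis gives the Lipschitz bound on the basis image only. Replacing the linear
part by its norm-preserving extension changes its values on the image by a constant, which is
absorbed in `r₀` at a base point `y₀`. -/
theorem exists_isLinearApprox {L : Set (Loss A d)} (hlam : 0 ≤ lam)
    (hs : IsApproxBasis s lam δ (lossFunctions L)) (hK : Convex ℝ (basisImage s)) {ℓ : Loss A d}
    (hℓ : ℓ ∈ L) : ∃ g : LinLoss A n, IsLinearApprox s lam δ ℓ g := by
  have h : ∀ a, ∃ (r₀ : ℝ) (r : Fin n → ℝ), (∀ y, |r₀ + ∑ i, r i * (s i y : ℝ) - ℓ a y| ≤ δ) ∧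
      ∀ w : Fin n → ℝ, |∑ i, r i * w i| ≤ lam * ‖w‖ := by
    intro a
    obtain ⟨r₀, r, h1, h2⟩ := hs _ ⟨ℓ, hℓ, a, rfl⟩
    let y₀ : Cube d := fun _ => 0
    obtain ⟨r', h3, h4⟩ := exists_lipschitz_extension hK ⟨_, Set.mem_range_self y₀⟩ hlam r (by
      rintro _ ⟨y, rfl⟩ _ ⟨y', rfl⟩; exact h2 y y')
    refine ⟨r₀ + ∑ i, r i * (s i y₀ : ℝ) - ∑ i, r' i * (s i y₀ : ℝ), r', fun y => ?_, h3⟩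
    have h5 := h4 _ (Set.mem_range_self y) _ (Set.mem_range_self y₀)
    simp only [basisVec, mul_sub, Finset.sum_sub_distrib] at h5
    have h6 := h1 y
    convert h6 using 2
    linarith
  choose r₀ r h1 h2 using h
  refine ⟨⟨r₀, r⟩, fun a y => h1 a y, fun a u _ v _ => ?_⟩
  simp only [LinLoss.eval, add_sub_add_left_eq_sub, ← Finset.sum_sub_distrib, ← mul_sub]
  exact h2 a (u - v)

/-- The loss with coefficients `k · γ`. -/
def LinLoss.ofInt (γ : ℝ) (k : (A → ℤ) × (A → Fin n → ℤ)) : LinLoss A n where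
  const := fun a => k.1 a * γ
  coeff := fun a i => k.2 a i * γ

theorem snap_eq_ofInt (g : LinLoss A n) : g.snap γ =
    LinLoss.ofInt γ (fun a => round (g.const a / γ), fun a i => round (g.coeff a i / γ)) := rfl

theorem abs_round_div_le (hγ : 0 < γ) {r b : ℝ} (h : |r| ≤ b) :
    |round (r / γ)| ≤ ⌊b / γ + 1 / 2⌋ := by
  rw [Int.le_floor]
  push_cast
  have h1 := abs_sub_round (r / γ)
  have h2 := abs_sub_abs_le_abs_sub (round (r / γ) : ℝ) (r / γ)
  rw [abs_sub_comm] at h1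
  have h3 : |r / γ| ≤ b / γ := by rw [abs_div, abs_of_pos hγ]; gcongr
  linarith

/-- Finiteness holds because the coefficients are bounded by `lam` and the constants by `lam + δ +
1`, so only finitely many integer multiples of `γ` occur. -/
theorem exists_isDiscretizedFamily [Finite A] {L : Set (Loss A d)} (hlam : 0 ≤ lam) (hγ : 0 < γ)
    (hs : IsApproxBasis s lam δ (lossFunctions L)) (hK : Convex ℝ (basisImage s)) :
    ∃ Lγ : Finset (LinLoss A n), IsDiscretizedFamily s lam δ γ L Lγ := by
  classical
  have h : ∀ ℓ : Loss A d, ∃ g : LinLoss A n, ℓ ∈ L → IsLinearApprox s lam δ ℓ g := fun ℓ => by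
    by_cases hℓ : ℓ ∈ L
    · obtain ⟨g, hg⟩ := exists_isLinearApprox hlam hs hK hℓ; exact ⟨g, fun _ => hg⟩
    · exact ⟨⟨0, 0⟩, fun h => absurd h hℓ⟩
  choose rep hrep using h
  have hfin : ((fun ℓ => (rep ℓ).snap γ) '' L).Finite := by
    set R : ℤ := ⌊(lam + δ + 1) / γ + 1 / 2⌋ with hR
    set S : ℤ := ⌊lam / γ + 1 / 2⌋ with hS
    have hf : (LinLoss.ofInt (A := A) (n := n) γ ''
        ((Set.univ.pi fun _ => Set.Icc (-R) R) ×ˢ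
          (Set.univ.pi fun _ => Set.univ.pi fun _ => Set.Icc (-S) S))).Finite :=
      ((Set.Finite.pi fun _ => Set.finite_Icc _ _).prod
        (Set.Finite.pi fun _ => Set.Finite.pi fun _ => Set.finite_Icc _ _)).image _
    refine hf.subset ?_
    rintro _ ⟨ℓ, hℓ, rfl⟩
    have hc := (hrep ℓ hℓ).sum_abs_coeff_le hlam
    refine ⟨_, ⟨fun a _ => ?_, fun a _ i _ => ?_⟩, (snap_eq_ofInt _).symm⟩
    · refine abs_le.1 (abs_round_div_le hγ ?_)
      have h1 := (hrep ℓ hℓ).1 a (fun _ => 0)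
      have h2 : |∑ i, (rep ℓ).coeff a i * basisVec s (fun _ => 0) i| ≤ lam := by
        refine (Finset.abs_sum_le_sum_abs _ _).trans
          ((Finset.sum_le_sum fun i _ => ?_).trans (hc a))
        rw [abs_mul]
        refine mul_le_of_le_one_right (abs_nonneg _) ?_
        rw [abs_of_nonneg ((basisVec_mem_Icc s _).1 i)]
        exact (basisVec_mem_Icc s _).2 i
      have h3 := (ℓ a (fun _ => 0)).2.1
      have h4 := (ℓ a (fun _ => 0)).2.2
      simp only [LinLoss.eval] at h1
      rw [abs_le] at h1 h2 ⊢
      constructor <;> linarith [h1.1, h1.2, h2.1, h2.2]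
    · exact abs_le.1 (abs_round_div_le hγ
        ((Finset.single_le_sum (f := fun i => |(rep ℓ).coeff a i|) (fun _ _ => abs_nonneg _)
          (Finset.mem_univ i)).trans (hc a)))
  exact ⟨hfin.toFinset, rep, hrep, by simp⟩

end Linear

/-! ### Compactness of convex hulls in finite dimension. -/

theorem sum_extend_zero {ι κ M : Type*} [Fintype ι] [Fintype κ] [AddCommMonoid M] (e : ι ↪ κ)
    (g : ι → M) : ∑ i, Function.extend e g 0 i = ∑ k, g k := by
  rw [← Finset.sum_subset (Finset.subset_univ (Finset.univ.map e)), Finset.sum_map]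
  · simp [e.injective.extend_apply]
  · intro i _ hi
    rw [Function.extend_apply']
    · rfl
    · simpa using hi

/-- By Carathéodory, `finrank + 1` points suffice, so the hull is a continuous image of a simplex
times a power of `S`. Shorter combinations are padded with weight `0` at the point `e₀`. -/
theorem isCompact_convexHull_of_isCompact {E : Type*} [NormedAddCommGroup E] [NormedSpace ℝ E]
    [FiniteDimensional ℝ E] {S : Set E} (hS : IsCompact S) : IsCompact (convexHull ℝ S) := by
  rcases S.eq_empty_or_nonempty with rfl | ⟨e₀, he₀⟩
  · simp
  let m := Module.finrank ℝ E + 1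
  let f : (Fin m → ℝ) × (Fin m → E) → E := fun q => ∑ i, q.1 i • q.2 i
  have hf : Continuous f := by fun_prop
  have hc : IsCompact (stdSimplex ℝ (Fin m) ×ˢ Set.univ.pi fun _ : Fin m => S) :=
    (isCompact_stdSimplex ℝ (Fin m)).prod (isCompact_univ_pi fun _ => hS)
  have heq : convexHull ℝ S = f '' (stdSimplex ℝ (Fin m) ×ˢ Set.univ.pi fun _ : Fin m => S) := by
    apply Set.Subset.antisymm
    · intro x hx
      obtain ⟨ι, _, z, w, hz, hind, hw, hsum, rfl⟩ := eq_pos_convex_span_of_mem_convexHull hx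
      have hcard : Fintype.card ι ≤ m := by
        have h1 := hind.card_le_finrank_succ
        have h2 := Submodule.finrank_le (vectorSpan ℝ (Set.range z))
        omega
      have hcard' : Fintype.card ι ≤ Fintype.card (Fin m) := by simpa using hcard
      obtain ⟨e⟩ := Function.Embedding.nonempty_of_card_le hcard'
      classical
      have hext : ∀ i, Function.extend e w 0 i • Function.extend e z (fun _ => e₀) i
          = Function.extend e (fun k => w k • z k) 0 i := by
        intro i
        by_cases hi : ∃ k, e k = i
        · obtain ⟨k, rfl⟩ := hi
          simp [e.injective.extend_apply]
        · simp [Function.extend_apply' _ _ _ hi]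
      refine ⟨(Function.extend e w 0, Function.extend e z fun _ => e₀), ⟨⟨fun i => ?_, ?_⟩, ?_⟩, ?_⟩
      · by_cases hi : ∃ k, e k = i
        · obtain ⟨k, rfl⟩ := hi
          simpa [e.injective.extend_apply] using (hw k).le
        · simp [Function.extend_apply' _ _ _ hi]
      · rw [← hsum, ← sum_extend_zero e]
      · intro i _
        by_cases hi : ∃ k, e k = i
        · obtain ⟨k, rfl⟩ := hi
          simpa [e.injective.extend_apply] using hz (Set.mem_range_self k)
        · simpa [Function.extend_apply' _ _ _ hi] using he₀
      · simp only [f, hext]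
        exact sum_extend_zero e _
    · rintro _ ⟨⟨w, z⟩, ⟨hw, hz⟩, rfl⟩
      exact (convex_convexHull ℝ S).sum_mem (fun i _ => hw.1 i) hw.2
        fun i _ => subset_convexHull ℝ S (hz i (Set.mem_univ i))
  rw [heq]
  exact hc.image hf

/-! ### The min-max problem, reduced to finitely many dimensions. -/

section Game

variable {n : ℕ}

/-- The pairing `(m₀, m) ↦ m₀ - ⟨m, v⟩`. -/
def pairing (v : Fin n → ℝ) : (ℝ × (Fin n → ℝ)) →L[ℝ] ℝ :=
  ContinuousLinearMap.fst ℝ ℝ (Fin n → ℝ) - ∑ i, v i •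
    (ContinuousLinearMap.proj (R := ℝ) (φ := fun _ : Fin n => ℝ) i).comp
      (ContinuousLinearMap.snd ℝ ℝ (Fin n → ℝ))

@[simp] theorem pairing_apply (v : Fin n → ℝ) (m : ℝ × (Fin n → ℝ)) :
    pairing v m = m.1 - ∑ i, v i * m.2 i := by
  simp [pairing]

/-- The pair `(⟨F(p), p⟩, F(p))`. -/
def moment (F : (Fin n → ℝ) → Fin n → ℝ) (p : Fin n → ℝ) : ℝ × (Fin n → ℝ) :=
  (∑ i, p i * F p i, F p)

/-- The worst value of the pairing over outcomes in `K`. -/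
def momentWorst (K : Set (Fin n → ℝ)) (m : ℝ × (Fin n → ℝ)) : ℝ :=
  sSup ((fun v => pairing v m) '' K)

theorem pairing_moment (F : (Fin n → ℝ) → Fin n → ℝ) (p v : Fin n → ℝ) :
    pairing v (moment F p) = ∑ i, F p i * (p i - v i) := by
  simp only [pairing_apply, moment, ← Finset.sum_sub_distrib]
  exact Finset.sum_congr rfl fun i _ => by ring

theorem pairing_sub_le {v : Fin n → ℝ} (hv : v ∈ Set.Icc (0 : Fin n → ℝ) 1)
    (m m' : ℝ × (Fin n → ℝ)) : pairing v m ≤ pairing v m' + (n + 1) * dist m m' := by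
  have h1 : m.1 - m'.1 ≤ dist m m' :=
    (le_abs_self _).trans ((Real.dist_eq _ _).symm.trans_le (le_max_left _ _))
  have h2 : ∀ i, v i * (m'.2 i - m.2 i) ≤ dist m m' := fun i => by
    have h3 : |m'.2 i - m.2 i| ≤ dist m m' := by
      rw [abs_sub_comm, ← Real.dist_eq]
      exact (dist_le_pi_dist _ _ i).trans (le_max_right _ _)
    have hv0 : 0 ≤ v i := hv.1 i
    have hv1 : v i ≤ 1 := hv.2 i
    have := le_abs_self (m'.2 i - m.2 i)
    nlinarith [abs_nonneg (m'.2 i - m.2 i)]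
  have h3 := Finset.sum_le_sum fun i (_ : i ∈ Finset.univ) => h2 i
  simp only [mul_sub, Finset.sum_sub_distrib, Finset.sum_const, Finset.card_univ, Fintype.card_fin,
    nsmul_eq_mul] at h3
  simp only [pairing_apply]
  linarith

theorem bddAbove_pairing {K : Set (Fin n → ℝ)} (hK : K ⊆ Set.Icc 0 1) (m : ℝ × (Fin n → ℝ)) :
    BddAbove ((fun v => pairing v m) '' K) := by
  refine ⟨(n + 1) * dist m 0, ?_⟩
  rintro _ ⟨v, hv, rfl⟩
  have := pairing_sub_le (hK hv) m 0
  simpa using this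

theorem lipschitzWith_momentWorst {K : Set (Fin n → ℝ)} (hK : K ⊆ Set.Icc 0 1) (hne : K.Nonempty) :
    LipschitzWith ((n : NNReal) + 1) (momentWorst K) := by
  refine LipschitzWith.of_le_add_mul _ fun m m' => csSup_le (hne.image _) ?_
  rintro _ ⟨v, hv, rfl⟩
  have h1 := pairing_sub_le (hK hv) m m'
  have h2 : pairing v m' ≤ momentWorst K m' :=
    le_csSup (bddAbove_pairing hK m') (Set.mem_image_of_mem _ hv)
  push_cast
  linarith

/-- The value of the game is at most `0`: against a mean outcome `v`, predict `p = v`. -/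
theorem exists_momentWorst_le {K : Set (Fin n → ℝ)} (hK : K ⊆ Set.Icc 0 1) (hne : K.Nonempty)
    (hconv : Convex ℝ K) {F : (Fin n → ℝ) → Fin n → ℝ} (hF : Continuous F) {ε : ℝ} (hε : 0 < ε) :
    ∃ m ∈ convexHull ℝ (moment F '' K), momentWorst K m ≤ ε := by
  obtain ⟨C, hC⟩ := isCompact_Icc.exists_bound_of_continuousOn
    (s := Set.Icc (0 : Fin n → ℝ) 1) hF.continuousOn
  have hC0 : 0 ≤ C := (norm_nonneg _).trans (hC 0 ⟨le_rfl, zero_le_one⟩)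
  have hbd : ∀ m ∈ convexHull ℝ (moment F '' K), ‖m.2‖ ≤ C := by
    intro m hm
    have hsub : convexHull ℝ (moment F '' K) ⊆ Prod.snd ⁻¹' Metric.closedBall (0 : Fin n → ℝ) C := by
      refine convexHull_min ?_
        ((convex_closedBall _ _).linear_preimage (LinearMap.snd ℝ ℝ (Fin n → ℝ)))
      rintro _ ⟨p, hp, rfl⟩
      simpa [moment] using hC p (hK hp)
    simpa using hsub hm
  -- A finite net of outcomes replaces `K`; moving `v` by the mesh changes the pairing by at most `n
  -- * C * mesh ≤ ε / 2`.
  obtain ⟨t, htK, htf, htc⟩ := Metric.finite_approx_of_totallyBounded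
    (isCompact_Icc.totallyBounded.subset hK) (ε / (2 * (n * C + 1))) (by positivity)
  have := htf.fintype
  let Λ : (ℝ × (Fin n → ℝ)) →ₗ[ℝ] (t → ℝ) := LinearMap.pi fun v => (pairing v.1).toLinearMap
  have hΛ : ∀ m v, Λ m v = pairing v.1 m := fun m v => rfl
  by_cases hdisj : Disjoint {z : t → ℝ | ∀ v, z v < ε / 2} (Λ '' convexHull ℝ (moment F '' K))
  -- If no mixture of predictions beat every outcome of the net, a hyperplane would separate the
  -- achievable payoff vectors from an open orthant. Its normal `c` is a mixed strategy of the
  -- adversary.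
  · exfalso
    have hopen : IsOpen {z : t → ℝ | ∀ v, z v < ε / 2} := by
      simp only [Set.ofPred_forall]
      exact isOpen_iInter_of_finite fun v => isOpen_lt (continuous_apply v) continuous_const
    have hcvx : Convex ℝ {z : t → ℝ | ∀ v, z v < ε / 2} := by
      simp only [Set.ofPred_forall]
      exact convex_iInter fun v => convex_halfSpace_lt (LinearMap.proj v).isLinear _
    obtain ⟨f, u, hfu, huf⟩ := geometric_hahn_banach_open hcvx hopen
      ((convex_convexHull ℝ _).linear_image Λ) hdisj
    have h0 : 0 < u := by
      have := hfu 0 (fun v => by simpa using hε)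
      simpa using this
    classical
    set c : t → ℝ := fun v => f (Pi.single v 1) with hc
    have hfc : ∀ z, f z = ∑ v, c v * z v := fun z => by
      have := LinearMap.pi_apply_eq_sum_univ (f : (t → ℝ) →ₗ[ℝ] ℝ) z
      simp only [ContinuousLinearMap.coe_coe, smul_eq_mul] at this
      rw [this]
      refine Finset.sum_congr rfl fun i _ => ?_
      rw [mul_comm, hc]; congr 2; ext j; simp [Pi.single_apply, eq_comm]
    have hcpos : ∀ v, 0 ≤ c v := by
      intro v
      by_contra hneg
      push Not at hneg
      -- For `c v < 0` this vector has nonpositive coordinates, so it lies in the orthant, yet `f`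
      -- takes the value `u` there.
      have := hfu ((u / c v) • Pi.single v 1) (fun w => by
        have : u / c v ≤ 0 := div_nonpos_of_nonneg_of_nonpos h0.le hneg.le
        by_cases hw : w = v
        · subst hw; simp; linarith
        · simp [hw]; linarith)
      rw [map_smul, smul_eq_mul] at this
      change u / c v * c v < u at this
      rw [div_mul_cancel₀ _ hneg.ne] at this
      exact lt_irrefl _ this
    have hsum : 0 < ∑ v, c v := by
      refine (Finset.sum_nonneg fun v _ => hcpos v).lt_of_ne fun h => ?_
      have hz : ∀ v, c v = 0 := fun v =>
        (Finset.sum_eq_zero_iff_of_nonneg fun v _ => hcpos v).1 h.symm v (Finset.mem_univ v)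
      obtain ⟨p, hp⟩ := hne
      have := huf _ ⟨_, subset_convexHull ℝ _ ⟨p, hp, rfl⟩, rfl⟩
      rw [hfc] at this
      simp only [hz, zero_mul, Finset.sum_const_zero] at this
      linarith
    have hvK : ∑ v, (c v / ∑ v, c v) • (v : Fin n → ℝ) ∈ K :=
      hconv.sum_mem (fun v _ => div_nonneg (hcpos v) hsum.le)
        (by rw [← Finset.sum_div, div_self hsum.ne']) fun v _ => htK v.2
    -- Predicting the mean outcome has `c`-average payoff exactly `0`, against the separating lower
    -- bound `u > 0`.
    set vb := ∑ v, (c v / ∑ v, c v) • (v : Fin n → ℝ) with hvb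
    have h1 := huf _ ⟨_, subset_convexHull ℝ _ ⟨vb, hvK, rfl⟩, rfl⟩
    have h2 : f (Λ (moment F vb)) = 0 := by
      rw [hfc]
      simp only [hΛ, pairing_moment, Finset.mul_sum]
      rw [Finset.sum_comm]
      refine Finset.sum_eq_zero fun i _ => ?_
      have h3 : vb i * ∑ v, c v = ∑ v, c v * (v : Fin n → ℝ) i := by
        rw [hvb, Finset.sum_apply, Finset.sum_mul]
        refine Finset.sum_congr rfl fun v _ => ?_
        simp only [Pi.smul_apply, smul_eq_mul]
        field_simp
      calc _ = F vb i * (vb i * ∑ v, c v - ∑ v, c v * (v : Fin n → ℝ) i) := by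
            rw [Finset.mul_sum, ← Finset.sum_sub_distrib, Finset.mul_sum]
            exact Finset.sum_congr rfl fun v _ => by ring
        _ = 0 := by rw [h3, sub_self, mul_zero]
    linarith
  · obtain ⟨_, hz, ⟨m, hm, rfl⟩⟩ := Set.not_disjoint_iff.1 hdisj
    refine ⟨m, hm, csSup_le (hne.image _) ?_⟩
    rintro _ ⟨v, hv, rfl⟩
    obtain ⟨v', hv', hvv⟩ := Set.mem_iUnion₂.1 (htc hv)
    have h1 : pairing v' m < ε / 2 := hz ⟨v', hv'⟩
    have h2 : pairing v m - pairing v' m ≤ n * C * (ε / (2 * (n * C + 1))) := by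
      have : pairing v m - pairing v' m = ∑ i, (v' i - v i) * m.2 i := by
        simp only [pairing_apply, sub_mul, Finset.sum_sub_distrib]; ring
      rw [this]
      have hi : ∀ i, (v' i - v i) * m.2 i ≤ ε / (2 * (n * C + 1)) * C := fun i => by
        refine (le_abs_self _).trans ?_
        rw [abs_mul]
        refine mul_le_mul ?_ ((norm_le_pi_norm m.2 i).trans (hbd m hm)) (abs_nonneg _)
          (by positivity)
        rw [abs_sub_comm, ← Real.dist_eq]
        exact (dist_le_pi_dist _ _ i).trans (Metric.mem_ball.1 hvv).le
      refine (Finset.sum_le_sum fun i _ => hi i).trans_eq ?_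
      simp; ring
    have h3 : n * C * (ε / (2 * (n * C + 1))) ≤ ε / 2 := by
      rw [mul_div_assoc', div_le_div_iff₀ (by positivity) (by positivity)]
      nlinarith [mul_nonneg (Nat.cast_nonneg (α := ℝ) n) hC0]
    simp only
    linarith

theorem continuous_moment {F : (Fin n → ℝ) → Fin n → ℝ} (hF : Continuous F) :
    Continuous (moment F) := by
  unfold moment; fun_prop

/-- The minimum of the worst value is attained, up to `tol`, by a convex combination. -/
theorem exists_momentWorst_minimizer {K : Set (Fin n → ℝ)} (hK : K ⊆ Set.Icc 0 1)
    (hne : K.Nonempty) {F : (Fin n → ℝ) → Fin n → ℝ} (hF : Continuous F) {tol : ℝ}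
    (htol : 0 ≤ tol) (h : 0 < tol ∨ IsClosed K) :
    ∃ m ∈ convexHull ℝ (moment F '' K), ∀ m' ∈ closure (convexHull ℝ (moment F '' K)),
      momentWorst K m ≤ momentWorst K m' + tol := by
  have hcont := (lipschitzWith_momentWorst hK hne).continuous
  have hcpt : IsCompact (closure (convexHull ℝ (moment F '' K))) := by
    refine (isCompact_convexHull_of_isCompact
      ((isCompact_Icc (a := (0 : Fin n → ℝ)) (b := 1)).image
        (continuous_moment hF))).closure_of_subset (convexHull_mono (Set.image_mono hK))
  obtain ⟨m₀, hm₀, hmin⟩ := hcpt.exists_isMinOn (hne.image _).convexHull.closure hcont.continuousOn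
  -- The minimum over the closed hull is attained. A positive tolerance allows a move into the hull
  -- itself; for closed `K` the hull is already closed.
  rcases h with h | h
  · obtain ⟨m, hm1, hm2⟩ := mem_closure_iff.1 hm₀ {m | momentWorst K m < momentWorst K m₀ + tol}
      (isOpen_lt hcont continuous_const) (by simpa using h)
    refine ⟨m, hm2, fun m' hm' => ?_⟩
    have h1 : momentWorst K m₀ ≤ momentWorst K m' := hmin hm'
    have h2 : momentWorst K m < momentWorst K m₀ + tol := hm1
    linarith
  · have hKc : IsCompact K := isCompact_Icc.of_isClosed_subset h hK
    have hcl := (isCompact_convexHull_of_isCompact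
      (hKc.image (continuous_moment hF))).isClosed.closure_eq
    refine ⟨m₀, hcl ▸ hm₀, fun m' hm' => ?_⟩
    have h1 : momentWorst K m₀ ≤ momentWorst K m' := hmin hm'
    linarith

end Game

/-! ### Finitely supported distributions. -/

section FiniteSupport

/-- The measure `∑ wᵢ δ_{zᵢ}`. -/
def atomic {ι Ω : Type*} [Fintype ι] [MeasurableSpace Ω] (w : ι → ℝ) (z : ι → Ω) : Measure Ω :=
  ∑ i, ENNReal.ofReal (w i) • Measure.dirac (z i)

variable {ι Ω : Type*} [Fintype ι] [MeasurableSpace Ω] {w : ι → ℝ} {z : ι → Ω}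

theorem atomic_apply [MeasurableSingletonClass Ω] (w : ι → ℝ) (z : ι → Ω) (S : Set Ω) :
    atomic w z S = ∑ i, ENNReal.ofReal (w i) * S.indicator 1 (z i) := by
  simp [atomic, Measure.finsetSum_apply]

theorem isProbabilityMeasure_atomic (hw : w ∈ stdSimplex ℝ ι) :
    IsProbabilityMeasure (atomic w z) := by
  constructor
  simp only [atomic, Measure.finsetSum_apply, Measure.smul_apply, measure_univ, smul_eq_mul,
    mul_one]
  rw [← ENNReal.ofReal_sum_of_nonneg fun i _ => hw.1 i, hw.2, ENNReal.ofReal_one]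

theorem ae_atomic [MeasurableSingletonClass Ω] {P : Ω → Prop} (h : ∀ i, P (z i)) :
    ∀ᵐ p ∂(atomic w z), P p := by
  rw [ae_iff, atomic_apply]
  exact Finset.sum_eq_zero fun i _ => by simp [h i]

/-- The function agrees almost everywhere with one that is constant off the finite set of atoms.
Hence broadcasting finitely many preimages needs no regularity of the losses or of the basis. -/
theorem aemeasurable_atomic [MeasurableSingletonClass Ω] {β : Type*} [MeasurableSpace β]
    (f : Ω → β) : AEMeasurable f (atomic w z) := by
  classical
  rcases isEmpty_or_nonempty ι with h | ⟨⟨i₀⟩⟩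
  · simp [atomic]
  · have hc : Measurable fun _ : Ω => f (z i₀) := measurable_const
    refine ⟨(Set.range z).piecewise f fun _ => f (z i₀), hc.measurable_of_countable_ne ?_,
      ae_atomic fun i => ?_⟩
    · refine (Set.finite_range z).countable.mono fun p hp => ?_
      by_contra hn
      exact hp (by simp [Set.piecewise_eq_of_notMem _ _ _ hn])
    · rw [Set.piecewise_eq_of_mem _ _ _ (Set.mem_range_self i)]

theorem map_atomic [MeasurableSingletonClass Ω] {Ω' : Type*} [MeasurableSpace Ω']
    [MeasurableSingletonClass Ω'] (f : Ω → Ω') : (atomic w z).map f = atomic w (f ∘ z) := by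
  ext S hS
  rw [Measure.map_apply_of_aemeasurable (aemeasurable_atomic f) hS, atomic_apply, atomic_apply]
  rfl

theorem integral_atomic [MeasurableSingletonClass Ω] {E : Type*} [NormedAddCommGroup E]
    [NormedSpace ℝ E] [CompleteSpace E] (hw : w ∈ stdSimplex ℝ ι) (f : Ω → E) :
    ∫ p, f p ∂(atomic w z) = ∑ i, w i • f (z i) := by
  rw [atomic, integral_finsetSum_measure]
  · refine Finset.sum_congr rfl fun i _ => ?_
    rw [integral_smul_measure, integral_dirac, ENNReal.toReal_ofReal (hw.1 i)]
  · intro i _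
    exact (integrable_dirac (by simp)).smul_measure ENNReal.ofReal_ne_top

end FiniteSupport

/-! ### Feasibility of the algorithm and its guarantee in one round. -/

section Objective

variable {X A : Type*} [Fintype A] {n : ℕ} {Lγ : Finset (LinLoss A n)} {C : Finset (X → A)} {η : ℝ}

theorem continuous_eval {A : Type*} {n : ℕ} (g : LinLoss A n) (a : A) : Continuous (g.eval a) := by
  unfold LinLoss.eval; fun_prop

theorem continuous_quantal [Nonempty A] (g : LinLoss A n) (a : A) :
    Continuous fun p => quantal η g.eval p a := by
  have := fun b => continuous_eval g b
  unfold quantal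
  exact Continuous.div (by fun_prop) (by fun_prop) fun p => (quantal_denom_pos g.eval p).ne'

theorem Event.continuous_val [Nonempty A] (E : Event Lγ C) (x : X) :
    Continuous (E.val η x) := by
  rcases E with ⟨ℓ, a⟩ | ⟨ℓ, a, b, c⟩
  · exact continuous_quantal ℓ.1 a
  · exact (continuous_quantal ℓ.1 a).mul continuous_const

theorem Event.val_nonneg (E : Event Lγ C) (x : X) (p : Fin n → ℝ) : 0 ≤ E.val η x p := by
  rcases E with ⟨ℓ, a⟩ | ⟨ℓ, a, b, c⟩
  · exact quantal_nonneg _ _ _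
  · exact mul_nonneg (quantal_nonneg _ _ _) (by split_ifs <;> simp)

theorem Event.val_le_one [Nonempty A] (E : Event Lγ C) (x : X) (p : Fin n → ℝ) :
    E.val η x p ≤ 1 := by
  rcases E with ⟨ℓ, a⟩ | ⟨ℓ, a, b, c⟩
  · exact quantal_le_one _ _ _
  · exact mul_le_one₀ (quantal_le_one _ _ _) (by split_ifs <;> simp) (by split_ifs <;> simp)

theorem continuous_bias [Nonempty A] (j : Expert Lγ C) (x : X) (v : Fin n → ℝ) :
    Continuous fun p => bias η j x p v := by
  have := j.1.continuous_val (η := η) x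
  unfold bias; fun_prop

theorem abs_bias_le {K : Set (Fin n → ℝ)} (hK : K ⊆ Set.Icc 0 1) (j : Expert Lγ C) (x : X)
    {p v : Fin n → ℝ} (hp : p ∈ K) (hv : v ∈ K) : |bias η j x p v| ≤ j.1.val η x p := by
  rw [bias, abs_mul, abs_mul, abs_of_nonneg (j.1.val_nonneg x p)]
  have h1 := abs_sub_le_one_of_mem_Icc (hK hp) (hK hv) j.2.1
  have h2 : |(if j.2.2 then (1 : ℝ) else -1)| = 1 := by split_ifs <;> simp
  rw [h2, one_mul]
  exact mul_le_of_le_one_right (j.1.val_nonneg x p) h1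

/-- The coefficient of `pᵢ - vᵢ` in the weighted bias. -/
def drift (η : ℝ) (w : Expert Lγ C → ℝ) (x : X) (p : Fin n → ℝ) (i : Fin n) : ℝ :=
  ∑ j : Expert Lγ C, if j.2.1 = i then w j * ((if j.2.2 then 1 else -1) * j.1.val η x p) else 0

theorem continuous_drift [Nonempty A] (w : Expert Lγ C → ℝ) (x : X) :
    Continuous (drift η w x) := by
  refine continuous_pi fun i => continuous_finsetSum _ fun j _ => ?_
  have := j.1.continuous_val (η := η) x
  split_ifs <;> fun_prop

theorem sum_mul_bias (w : Expert Lγ C → ℝ) (x : X) (p v : Fin n → ℝ) :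
    ∑ j, w j * bias η j x p v = pairing v (moment (drift η w x) p) := by
  simp only [pairing_moment, drift, Finset.sum_mul]
  rw [Finset.sum_comm]
  refine Finset.sum_congr rfl fun j _ => ?_
  simp only [ite_mul, zero_mul, Finset.sum_ite_eq, Finset.mem_univ, if_true, bias]
  split_ifs <;> ring

variable {K : Set (Fin n → ℝ)} {π : Measure (Fin n → ℝ)}

theorem IsDistributionOn.integrable (hπ : IsDistributionOn K π) (hK : K ⊆ Set.Icc 0 1)
    {E : Type*} [NormedAddCommGroup E] [SecondCountableTopology E] {f : (Fin n → ℝ) → E}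
    (hf : Continuous f) : Integrable f π := by
  have := hπ.1
  obtain ⟨B, hB⟩ := isCompact_Icc.exists_bound_of_continuousOn
    (s := Set.Icc (0 : Fin n → ℝ) 1) hf.continuousOn
  borelize E
  exact Integrable.of_bound hf.measurable.aestronglyMeasurable B
    (hπ.2.mono fun p hp => hB p (hK hp))

/-- The objective depends on `π` only through the mean of `moment`, a point of `ℝ × ℝⁿ`. -/
theorem objective_eq_pairing [Nonempty A] (hπ : IsDistributionOn K π) (hK : K ⊆ Set.Icc 0 1)
    (w : Expert Lγ C → ℝ) (x : X) (v : Fin n → ℝ) :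
    objective η w x π v = pairing v (∫ p, moment (drift η w x) p ∂π) := by
  rw [objective, ← ContinuousLinearMap.integral_comp_comm _
    (hπ.integrable hK (continuous_moment (continuous_drift w x)))]
  simp only [sum_mul_bias]

theorem worstCase_eq_momentWorst [Nonempty A] (hπ : IsDistributionOn K π)
    (hK : K ⊆ Set.Icc 0 1) (w : Expert Lγ C → ℝ) (x : X) :
    worstCase η K w x π = momentWorst K (∫ p, moment (drift η w x) p ∂π) := by
  rw [worstCase, momentWorst]
  congr 1
  exact Set.image_congr fun v _ => objective_eq_pairing hπ hK w x v

theorem exists_atomic_of_mem_convexHull {d : ℕ} {s : Fin n → Cube d → unitInterval}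
    {F : (Fin n → ℝ) → Fin n → ℝ} {m : ℝ × (Fin n → ℝ)}
    (hm : m ∈ convexHull ℝ (moment F '' basisImage s)) :
    ∃ (N : ℕ) (w : Fin N → ℝ) (z : Fin N → Cube d), w ∈ stdSimplex ℝ (Fin N) ∧
      ∫ p, moment F p ∂(atomic w (basisVec s ∘ z)) = m := by
  obtain ⟨ι, _, w, z, hw0, hw1, hz, rfl⟩ := mem_convexHull_iff_exists_fintype.1 hm
  have h : ∀ i, ∃ y, moment F (basisVec s y) = z i := fun i => by
    obtain ⟨_, ⟨y, rfl⟩, h⟩ := hz i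
    exact ⟨y, h⟩
  choose y hy using h
  let e := Fintype.equivFin ι
  have hw : w ∘ e.symm ∈ stdSimplex ℝ (Fin (Fintype.card ι)) :=
    ⟨fun i => hw0 _, by rw [← hw1]; exact e.symm.sum_comp w⟩
  refine ⟨_, w ∘ e.symm, y ∘ e.symm, hw, ?_⟩
  rw [integral_atomic hw]
  simp only [Function.comp_apply, hy]
  exact e.symm.sum_comp fun i => w i • z i

theorem isDistributionOn_atomic {d : ℕ} (s : Fin n → Cube d → unitInterval) {N : ℕ}
    {w : Fin N → ℝ} (z : Fin N → Cube d) (hw : w ∈ stdSimplex ℝ (Fin N)) :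
    IsDistributionOn (basisImage s) (atomic w (basisVec s ∘ z)) :=
  ⟨isProbabilityMeasure_atomic hw, ae_atomic fun i => Set.mem_range_self (z i)⟩

/-- The mean of any competing distribution lies in the closed convex hull of the moments, so a
finitely supported law realizing a near-minimal point of the hull competes with all of them. -/
theorem exists_atomic_minimizer [Nonempty A] {d : ℕ} (s : Fin n → Cube d → unitInterval) {tol : ℝ}
    (htol : 0 ≤ tol) (h : 0 < tol ∨ IsClosed (basisImage s)) (w : Expert Lγ C → ℝ) (x : X) :
    ∃ μ : Measure (Cube d), IsProbabilityMeasure μ ∧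
      (∀ (β : Type) [MeasurableSpace β] (f : Cube d → β), AEMeasurable f μ) ∧
      IsDistributionOn (basisImage s) (μ.map (basisVec s)) ∧
      ∀ π', IsDistributionOn (basisImage s) π' →
        worstCase η (basisImage s) w x (μ.map (basisVec s))
          ≤ worstCase η (basisImage s) w x π' + tol := by
  have hK := basisImage_subset_Icc s
  have hne : (basisImage s).Nonempty := ⟨_, Set.mem_range_self fun _ => 0⟩
  obtain ⟨m, hm, hmin⟩ := exists_momentWorst_minimizer hK hne
    (continuous_drift (η := η) w x) htol h
  obtain ⟨N, wt, z, hwt, hint⟩ := exists_atomic_of_mem_convexHull hm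
  refine ⟨atomic wt z, isProbabilityMeasure_atomic hwt, fun β _ f => aemeasurable_atomic f, ?_, ?_⟩
  · rw [map_atomic]; exact isDistributionOn_atomic s z hwt
  · intro π' hπ'
    rw [map_atomic, worstCase_eq_momentWorst (isDistributionOn_atomic s z hwt) hK,
      worstCase_eq_momentWorst hπ' hK, hint]
    apply hmin
    have := hπ'.1
    exact (convex_convexHull ℝ _).closure.integral_mem isClosed_closure
      (hπ'.2.mono fun p hp => subset_closure (subset_convexHull ℝ _ ⟨p, hp, rfl⟩))
      (hπ'.integrable hK (continuous_moment (continuous_drift w x)))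

/-- The biases produced by a forecaster that plays `sel w x` in response to weights `w`. -/
def runBias (η : ℝ) (W : List (Expert Lγ C → ℝ) → Expert Lγ C → ℝ)
    (sel : (Expert Lγ C → ℝ) → X → Measure (Fin n → ℝ)) :
    List (X × (Fin n → ℝ)) → List (Expert Lγ C → ℝ)
  | [] => []
  | (x, v) :: h => (fun j => ∫ p, bias η j x p v ∂(sel (W (runBias η W sel h)) x)) ::
      runBias η W sel h

/-- The forecaster reads the past biases, which are themselves computed from the forecaster. The
recursion `runBias` resolves this circularity, and here it is seen to produce the biases of the
forecaster it defines. -/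
theorem pastBias_runBias (W : List (Expert Lγ C → ℝ) → Expert Lγ C → ℝ)
    (sel : (Expert Lγ C → ℝ) → X → Measure (Fin n → ℝ)) (h : List (X × (Fin n → ℝ))) :
    pastBias η (fun h x => sel (W (runBias η W sel h)) x) h = runBias η W sel h := by
  induction h with
  | nil => rfl
  | cons r h ih => obtain ⟨x, v⟩ := r; simp only [pastBias, runBias, ih]

theorem exists_isSmoothDecisionSwap [Nonempty A] {d : ℕ} (s : Fin n → Cube d → unitInterval)
    (L : Set (Loss A d)) (W : List (Expert Lγ C → ℝ) → Expert Lγ C → ℝ) {tol : ℝ}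
    (htol : 0 ≤ tol) (h : 0 < tol ∨ IsClosed (basisImage s)) :
    ∃ B : Forecaster X n (Cube d), IsSmoothDecisionSwap s L η tol W B := by
  choose μ hμ1 hμ2 hμ3 hμ4 using
    fun (w : Expert Lγ C → ℝ) x => exists_atomic_minimizer (η := η) s htol h w x
  let sel : (Expert Lγ C → ℝ) → X → Measure (Fin n → ℝ) := fun w x => (μ w x).map (basisVec s)
  refine ⟨fun h x => μ (W (runBias η W sel h)) x,
    fun h x => sel (W (runBias η W sel h)) x, fun h _ x => ?_, fun h _ x => ?_⟩
  · rw [pastBias_runBias]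
    exact ⟨hμ3 _ x, hμ4 _ x⟩
  · exact ⟨hμ1 _ x, hμ2 _ x _ _, rfl, fun ℓ _ a => hμ2 _ x _ _⟩

/-- In every round, the weighted bias of unbiased prediction is at most the tolerance. -/
theorem IsUnbiasedPrediction.sum_mul_integral_bias_le [Nonempty A] {d : ℕ}
    {s : Fin n → Cube d → unitInterval} (hconv : Convex ℝ (basisImage s)) {tol : ℝ}
    {W : List (Expert Lγ C → ℝ) → Expert Lγ C → ℝ} {F : Forecaster X n (Fin n → ℝ)}
    (hF : IsUnbiasedPrediction η tol (basisImage s) W F) {h : List (X × (Fin n → ℝ))}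
    (hh : ∀ r ∈ h, r.2 ∈ basisImage s) (x : X) {v : Fin n → ℝ} (hv : v ∈ basisImage s) :
    ∑ j, W (pastBias η F h) j * ∫ p, bias η j x p v ∂(F h x) ≤ tol := by
  have hK := basisImage_subset_Icc s
  obtain ⟨hdist, hopt⟩ := hF h hh x
  set w := W (pastBias η F h)
  have h1 : ∑ j, w j * ∫ p, bias η j x p v ∂(F h x) = objective η w x (F h x) v := by
    rw [objective, integral_finsetSum]
    · simp only [integral_const_mul]
    · exact fun j _ => (hdist.integrable hK (continuous_bias j x v)).const_mul _
  have h2 : objective η w x (F h x) v ≤ worstCase η (basisImage s) w x (F h x) := by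
    rw [objective_eq_pairing hdist hK, worstCase_eq_momentWorst hdist hK]
    exact le_csSup (bddAbove_pairing hK _) (Set.mem_image_of_mem _ hv)
  rw [h1]
  -- The value of the game is nonpositive only up to each `ε > 0`, which is enough here.
  refine h2.trans (le_of_forall_pos_le_add fun ε hε => ?_)
  obtain ⟨m, hm, hle⟩ := exists_momentWorst_le hK ⟨v, hv⟩ hconv (continuous_drift (η := η) w x) hε
  obtain ⟨N, wt, z, hwt, hint⟩ := exists_atomic_of_mem_convexHull hm
  have h3 := hopt _ (isDistributionOn_atomic s z hwt)
  rw [worstCase_eq_momentWorst (isDistributionOn_atomic s z hwt) hK, hint] at h3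
  linarith

end Objective

/-! ### Exponential weights with a second-order correction. -/

section Weights

variable {J : Type*}

/-- The exponential weight `exp (θ ∑ g - θ² ∑ g²)` of an index after the past gains `g`. -/
def expWeight (θ : ℝ) (h : List (J → ℝ)) (j : J) : ℝ :=
  Real.exp (h.map fun g => θ * g j - (θ * g j) ^ 2).sum

open scoped Classical in
/-- The weights `expWeight`, restricted to `R` and normalized. -/
def expRule (R : Finset J) (θ : ℝ) (h : List (J → ℝ)) (j : J) : ℝ :=
  if j ∈ R then expWeight θ h j / ∑ k ∈ R, expWeight θ h k else 0

variable {R : Finset J} {θ : ℝ}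

theorem sum_expWeight_pos (hR : R.Nonempty) (h : List (J → ℝ)) : 0 < ∑ k ∈ R, expWeight θ h k :=
  Finset.sum_pos (fun _ _ => Real.exp_pos _) hR

theorem sum_expRule_mul [Fintype J] (R : Finset J) (h : List (J → ℝ)) (g : J → ℝ) :
    ∑ j, expRule R θ h j * g j
      = (∑ j ∈ R, expWeight θ h j * g j) / ∑ k ∈ R, expWeight θ h k := by
  classical
  rw [Finset.sum_div, ← Finset.sum_subset (Finset.subset_univ R)]
  · exact Finset.sum_congr rfl fun j hj => by rw [expRule, if_pos hj]; ring
  · intro j _ hj; rw [expRule, if_neg hj, zero_mul]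

theorem expRule_mem_stdSimplex [Fintype J] (hR : R.Nonempty) (h : List (J → ℝ)) :
    expRule R θ h ∈ stdSimplex ℝ J := by
  constructor
  · intro j
    unfold expRule
    split_ifs
    · exact div_nonneg (Real.exp_pos _).le (sum_expWeight_pos hR h).le
    · exact le_rfl
  · have := sum_expRule_mul (θ := θ) R h fun _ => 1
    simp only [mul_one] at this
    rw [this, div_self (sum_expWeight_pos hR h).ne']

/-- The correction `-(θ g)²` makes each new factor at most `1 + θ g`, so the total weight grows only
by the weighted average of the gains. -/
theorem sum_expWeight_cons_le [Fintype J] (hR : R.Nonempty) (hθ : 0 ≤ θ) {g : J → ℝ}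
    (hg : ∀ j, |θ * g j| ≤ 1 / 2) {τ : ℝ} {h : List (J → ℝ)}
    (hτ : ∑ j, expRule R θ h j * g j ≤ τ) :
    ∑ j ∈ R, expWeight θ (g :: h) j ≤ (∑ j ∈ R, expWeight θ h j) * (1 + θ * τ) := by
  rw [sum_expRule_mul, div_le_iff₀ (sum_expWeight_pos hR h)] at hτ
  calc ∑ j ∈ R, expWeight θ (g :: h) j ≤ ∑ j ∈ R, expWeight θ h j * (1 + θ * g j) := by
        refine Finset.sum_le_sum fun j _ => ?_
        rw [expWeight, List.map_cons, List.sum_cons, add_comm, Real.exp_add]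
        exact mul_le_mul_of_nonneg_left (exp_sub_sq_le (hg j)) (Real.exp_pos _).le
    _ = ∑ j ∈ R, expWeight θ h j + θ * ∑ j ∈ R, expWeight θ h j * g j := by
        rw [Finset.mul_sum, ← Finset.sum_add_distrib]
        exact Finset.sum_congr rfl fun j _ => by ring
    _ ≤ _ := by nlinarith [mul_le_mul_of_nonneg_left hτ hθ]

end Weights

/-! ### Cumulative bias of each triple. -/

section Regret

theorem sum_map_pastBias_history {X A : Type*} [Fintype A] {n : ℕ}
    {Lγ : Finset (LinLoss A n)} {C : Finset (X → A)} (η : ℝ) (F : Forecaster X n (Fin n → ℝ)) (x : ℕ → X)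
    (v : ℕ → Fin n → ℝ) (f : (Expert Lγ C → ℝ) → ℝ) (T : ℕ) :
    ((pastBias η F (history x v T)).map f).sum = ∑ t ∈ Finset.range T,
      f fun j => ∫ p, bias η j (x t) p (v t) ∂(F (history x v t) (x t)) := by
  induction T with
  | zero => simp [history, pastBias]
  | succ T ih =>
    rw [Finset.sum_range_succ, ← ih]
    exact (List.sum_cons (α := ℝ)).trans (add_comm _ _)

variable {X A : Type*} [Fintype A] [Nonempty A] {d n : ℕ} {Lγ : Finset (LinLoss A n)}
  {C : Finset (X → A)} {η : ℝ} {s : Fin n → Cube d → unitInterval}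
  {F : Forecaster X n (Fin n → ℝ)}

/-- Bounding by the mass of the event rather than by `1` is what makes the second-order bound pay
off: rare events have small quadratic terms. -/
theorem IsDistributionOn.abs_integral_bias_le {K : Set (Fin n → ℝ)} {π : Measure (Fin n → ℝ)}
    (hπ : IsDistributionOn K π) (hK : K ⊆ Set.Icc 0 1) (j : Expert Lγ C) (x : X) {v : Fin n → ℝ}
    (hv : v ∈ K) : |∫ p, bias η j x p v ∂π| ≤ ∫ p, j.1.val η x p ∂π := by
  refine (abs_integral_le_integral_abs).trans (integral_mono_ae
    (hπ.integrable hK (continuous_bias j x v)).abs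
    (hπ.integrable hK (j.1.continuous_val x)) ?_)
  exact hπ.2.mono fun p hp => abs_bias_le hK j x hp hv

theorem IsDistributionOn.integral_val_le_one {K : Set (Fin n → ℝ)} {π : Measure (Fin n → ℝ)}
    (hπ : IsDistributionOn K π) (hK : K ⊆ Set.Icc 0 1) (E : Event Lγ C) (x : X) :
    ∫ p, E.val η x p ∂π ≤ 1 := by
  have := hπ.1
  calc _ ≤ ∫ _, (1 : ℝ) ∂π := integral_mono (hπ.integrable hK (E.continuous_val x))
        (integrable_const _) fun p => E.val_le_one x p
    _ = 1 := by simp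

/-- The total weight starts at `|R|`, and each round multiplies it by at most `1 + θ * tol`. -/
theorem IsUnbiasedPrediction.sum_expWeight_le (hconv : Convex ℝ (basisImage s))
    {R : Finset (Expert Lγ C)} (hR : R.Nonempty) {θ tol : ℝ} (hθ0 : 0 ≤ θ) (hθ : θ ≤ 1 / 2)
    (htol : 0 ≤ tol) (hF : IsUnbiasedPrediction η tol (basisImage s) (expRule R θ) F)
    (h : List (X × (Fin n → ℝ))) (hh : ∀ r ∈ h, r.2 ∈ basisImage s) :
    ∑ j ∈ R, expWeight θ (pastBias η F h) j ≤ R.card * (1 + θ * tol) ^ h.length := by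
  induction h with
  | nil => simp [pastBias, expWeight]
  | cons r h ih =>
    obtain ⟨x, v⟩ := r
    have hh' : ∀ r ∈ h, r.2 ∈ basisImage s := fun r hr => hh r (List.mem_cons_of_mem _ hr)
    have hv : v ∈ basisImage s := hh (x, v) List.mem_cons_self
    have hdist := (hF h hh' x).1
    have hK := basisImage_subset_Icc s
    have hstep := sum_expWeight_cons_le hR hθ0 (g := fun j => ∫ p, bias η j x p v ∂(F h x))
      (fun j => by
        rw [abs_mul, abs_of_nonneg hθ0]
        have h1 := (hdist.abs_integral_bias_le (η := η) hK j x hv).trans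
          (hdist.integral_val_le_one hK j.1 x)
        nlinarith [abs_nonneg (∫ p, bias η j x p v ∂(F h x))])
      (hF.sum_mul_integral_bias_le hconv hh' x hv)
    rw [List.length_cons, pow_succ, ← mul_assoc]
    exact hstep.trans (mul_le_mul_of_nonneg_right (ih hh') (by positivity))

theorem history_length {V : Type*} (x : ℕ → X) (v : ℕ → V) (T : ℕ) :
    (history x v T).length = T := by
  induction T with
  | zero => rfl
  | succ T ih => simp [history, ih]

theorem history_mem {V : Type*} {x : ℕ → X} {v : ℕ → V} {K : Set V} (hv : ∀ t, v t ∈ K) (T : ℕ) :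
    ∀ r ∈ history x v T, r.2 ∈ K := by
  induction T with
  | zero => simp [history]
  | succ T ih =>
    intro r hr
    rcases List.mem_cons.1 hr with rfl | hr
    · exact hv T
    · exact ih r hr

/-- A single weight is at most the total weight; take logarithms, with `1 + θ * tol ≤ exp (θ *
tol)`. -/
theorem IsUnbiasedPrediction.sum_bias_le (hconv : Convex ℝ (basisImage s))
    {R : Finset (Expert Lγ C)} {θ tol : ℝ} (hθ0 : 0 ≤ θ) (hθ : θ ≤ 1 / 2)
    (htol : 0 ≤ tol) (hF : IsUnbiasedPrediction η tol (basisImage s) (expRule R θ) F)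
    (x : ℕ → X) {v : ℕ → Fin n → ℝ} (hv : ∀ t, v t ∈ basisImage s) (T : ℕ) {j : Expert Lγ C}
    (hj : j ∈ R) :
    θ * ∑ t ∈ Finset.range T, ∫ p, bias η j (x t) p (v t) ∂(F (history x v t) (x t)) ≤
      θ ^ 2 * ∑ t ∈ Finset.range T, (∫ p, bias η j (x t) p (v t) ∂(F (history x v t) (x t))) ^ 2
      + Real.log R.card + θ * tol * T := by
  have hR : R.Nonempty := ⟨j, hj⟩
  have hcard : (0 : ℝ) < R.card := by exact_mod_cast hR.card_pos
  have h1 := hF.sum_expWeight_le hconv hR hθ0 hθ htol _ (history_mem (x := x) hv T)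
  rw [history_length] at h1
  have h2 := (Finset.single_le_sum (f := expWeight θ (pastBias η F (history x v T)))
    (fun _ _ => (Real.exp_pos _).le) hj).trans h1
  have h3 : R.card * (1 + θ * tol) ^ T ≤ Real.exp (Real.log R.card + θ * tol * T) := by
    rw [Real.exp_add, Real.exp_log hcard, mul_comm (θ * tol) (T : ℝ), Real.exp_nat_mul]
    gcongr
    rw [add_comm]; exact Real.add_one_le_exp _
  have h4 := Real.exp_le_exp.1 (h2.trans h3)
  rw [sum_map_pastBias_history] at h4
  simp only [mul_pow, Finset.sum_sub_distrib, ← Finset.mul_sum] at h4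
  linarith

end Regret

/-! ### A small set of representatives of the discretized losses. -/

section Representatives

theorem round_snap_const {A : Type*} {n : ℕ} {γ : ℝ} (hγ : 0 < γ) (g : LinLoss A n) (a : A) :
    (round ((g.snap γ).const a / γ) : ℝ) * γ = (g.snap γ).const a := by
  simp [LinLoss.snap, hγ.ne']

theorem round_snap_coeff {A : Type*} {n : ℕ} {γ : ℝ} (hγ : 0 < γ) (g : LinLoss A n) (a : A) (i : Fin n) :
    (round ((g.snap γ).coeff a i / γ) : ℝ) * γ = (g.snap γ).coeff a i := by
  simp [LinLoss.snap, hγ.ne']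

variable {A : Type*} [Fintype A] [Nonempty A] {d n : ℕ} {s : Fin n → Cube d → unitInterval}
  {lam δ γ : ℝ}

/-- The smallest constant coefficient, in multiples of `γ`. -/
def minConst (γ : ℝ) (g : LinLoss A n) : ℤ :=
  Finset.univ.inf' Finset.univ_nonempty fun a => round (g.const a / γ)

/-- The integer coefficients of a loss and the offsets of its constants, truncated at `M`. -/
def truncKey (γ : ℝ) (M : ℕ) (g : LinLoss A n) : (A → Fin n → ℤ) × (A → ℤ) :=
  (fun a i => round (g.coeff a i / γ), fun a => min (round (g.const a / γ) - minConst γ g) M)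

theorem minConst_le (g : LinLoss A n) (a : A) : minConst γ g ≤ round (g.const a / γ) :=
  Finset.inf'_le _ (Finset.mem_univ a)

/-- One loss is kept for each value of `truncKey`. The cardinality bound is free of `δ` because
constants enter only through offsets from their minimum, cut off at `M`. Losses with equal keys have
equal coefficients, and their offsets agree unless both reach `M * γ`. -/
theorem exists_representatives {L : Set (Loss A d)} (hL : L.Nonempty) (hn : 0 < n) (hγ : 0 < γ)
    (hlam : n * γ < lam) {Lγ : Finset (LinLoss A n)} (hLγ : IsDiscretizedFamily s lam δ γ L Lγ)
    (M : ℕ) :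
    ∃ S ⊆ Lγ, S.Nonempty ∧
      (S.card : ℝ) ≤ (4 * (lam / γ)) ^ (n * Fintype.card A) * (M + 1 : ℝ) ^ Fintype.card A ∧
      ∀ g ∈ Lγ, ∃ h ∈ S, h.coeff = g.coeff ∧ ∃ (kg kh : ℝ) (og oh : A → ℝ),
        (∀ a, g.const a = kg + og a) ∧ (∀ a, h.const a = kh + oh a) ∧ (∃ b, og b = 0) ∧
        ∀ a, og a = oh a ∨ (M * γ ≤ og a ∧ M * γ ≤ oh a) := by
  classical
  obtain ⟨rep, hrep, hcoe⟩ := hLγ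
  have hmem : ∀ g ∈ Lγ, ∃ ℓ ∈ L, (rep ℓ).snap γ = g := fun g hg => by
    have : g ∈ (Lγ : Set (LinLoss A n)) := hg
    rw [hcoe] at this
    exact this
  have hn1 : (1 : ℝ) ≤ n := by exact_mod_cast hn
  have hlam0 : 0 ≤ lam := by nlinarith
  have hratio : 1 ≤ lam / γ := by rw [le_div_iff₀ hγ]; nlinarith
  obtain ⟨S, hS, hinj, himg⟩ := Finset.exists_subset_injOn_image_eq_of_surjOn (f := truncKey γ M)
    (Lγ : Set (LinLoss A n)) (Lγ.image (truncKey γ M)) (by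
      rw [Finset.coe_image]; exact Set.surjOn_image _ _)
  have hS' : S ⊆ Lγ := hS
  refine ⟨S, hS', ?_, ?_, ?_⟩
  · obtain ⟨ℓ, hℓ⟩ := hL
    have hne : Lγ.Nonempty :=
      ⟨(rep ℓ).snap γ, by rw [← Finset.mem_coe, hcoe]; exact ⟨ℓ, hℓ, rfl⟩⟩
    rw [← Finset.image_nonempty (f := truncKey γ M), himg]
    exact hne.image _
  · set R : ℤ := ⌊lam / γ + 1 / 2⌋ with hR
    have hR0 : 0 ≤ R := Int.floor_nonneg.2 (by positivity)
    have hsub : S.image (truncKey γ M) ⊆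
        (Fintype.piFinset fun _ : A => Fintype.piFinset fun _ : Fin n => Finset.Icc (-R) R) ×ˢ
          Fintype.piFinset fun _ : A => Finset.Icc (0 : ℤ) M := by
      rw [himg]
      intro k hk
      obtain ⟨g, hg, rfl⟩ := Finset.mem_image.1 hk
      obtain ⟨ℓ, hℓ, rfl⟩ := hmem g hg
      have hc := (hrep ℓ hℓ).sum_abs_coeff_le hlam0
      simp only [Finset.mem_product, Fintype.mem_piFinset, Finset.mem_Icc, truncKey]
      refine ⟨fun a i => ?_, fun a => ⟨le_min ?_ (by positivity), min_le_right _ _⟩⟩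
      · have h1 : round (((rep ℓ).snap γ).coeff a i / γ) = round ((rep ℓ).coeff a i / γ) := by
          simp [LinLoss.snap, hγ.ne']
        rw [h1]
        exact abs_le.1 (abs_round_div_le hγ
          ((Finset.single_le_sum (f := fun i => |(rep ℓ).coeff a i|) (fun _ _ => abs_nonneg _)
            (Finset.mem_univ i)).trans (hc a)))
      · exact sub_nonneg.2 (minConst_le _ a)
    have hcard := Finset.card_le_card hsub
    rw [Finset.card_image_of_injOn hinj, Finset.card_product] at hcard
    simp only [Fintype.card_piFinset, Finset.prod_const, Finset.card_univ, Fintype.card_fin,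
      Int.card_Icc, ← pow_mul] at hcard
    -- There are `2R + 1 ≤ 2 lam / γ + 2` values, and `lam / γ ≥ 1`.
    have h1 : ((R + 1 - -R).toNat : ℝ) ≤ 4 * (lam / γ) := by
      have h2 : (((R + 1 - -R).toNat : ℤ) : ℝ) = 2 * R + 1 := by
        rw [Int.toNat_of_nonneg (by omega)]; push_cast; ring
      rw [Int.cast_natCast] at h2
      have h3 : (R : ℝ) ≤ lam / γ + 1 / 2 := Int.floor_le _
      linarith
    have h2 : (((M : ℤ) + 1 - 0).toNat : ℝ) = M + 1 := by
      have : ((M : ℤ) + 1 - 0).toNat = M + 1 := by omega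
      rw [this]; push_cast; ring
    calc (S.card : ℝ) ≤ ((R + 1 - -R).toNat : ℝ) ^ (n * Fintype.card A)
          * (((M : ℤ) + 1 - 0).toNat : ℝ) ^ Fintype.card A := by exact_mod_cast hcard
      _ ≤ _ := by rw [h2]; gcongr
  · intro g hg
    have : truncKey γ M g ∈ S.image (truncKey γ M) := by
      rw [himg]; exact Finset.mem_image_of_mem _ hg
    obtain ⟨h, hh, hkey⟩ := Finset.mem_image.1 this
    obtain ⟨ℓ, -, rfl⟩ := hmem g hg
    obtain ⟨ℓ', -, rfl⟩ := hmem h (hS' hh)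
    have hk1 := congrArg Prod.fst hkey
    have hk2 := congrArg Prod.snd hkey
    refine ⟨_, hh, ?_, minConst γ ((rep ℓ).snap γ) * γ, minConst γ ((rep ℓ').snap γ) * γ,
      fun a => (round (((rep ℓ).snap γ).const a / γ) - minConst γ ((rep ℓ).snap γ) : ℤ) * γ,
      fun a => (round (((rep ℓ').snap γ).const a / γ) - minConst γ ((rep ℓ').snap γ) : ℤ) * γ,
      fun a => ?_, fun a => ?_, ?_, fun a => ?_⟩
    · funext a i
      have := congrFun (congrFun hk1 a) i
      simp only [truncKey] at this
      rw [← round_snap_coeff hγ, this, round_snap_coeff hγ]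
    · push_cast; rw [sub_mul, round_snap_const hγ]; ring
    · push_cast; rw [sub_mul, round_snap_const hγ]; ring
    · obtain ⟨b, -, hb⟩ := Finset.exists_mem_eq_inf' Finset.univ_nonempty
        fun a => round (((rep ℓ).snap γ).const a / γ)
      refine ⟨b, ?_⟩
      have : minConst γ ((rep ℓ).snap γ) = round (((rep ℓ).snap γ).const b / γ) := hb
      rw [this]; simp
    · have := congrFun hk2 a
      simp only [truncKey] at this
      beta_reduce
      generalize round (((rep ℓ).snap γ).const a / γ) - minConst γ ((rep ℓ).snap γ) = z at *
      generalize round (((rep ℓ').snap γ).const a / γ) - minConst γ ((rep ℓ').snap γ) = z' at *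
      have hz : z = z' ∨ ((M : ℤ) ≤ z ∧ (M : ℤ) ≤ z') := by omega
      rcases hz with rfl | ⟨h1, h2⟩
      · exact Or.inl rfl
      · refine Or.inr ⟨?_, ?_⟩
        · exact mul_le_mul_of_nonneg_right (by exact_mod_cast h1) hγ.le
        · exact mul_le_mul_of_nonneg_right (by exact_mod_cast h2) hγ.le

end Representatives

/-! ### From conditional biases to swap regret. -/

section RegretBound

theorem abs_sum_coeff_mul_le {A : Type*} {n : ℕ} {g : LinLoss A n} {ρ : ℝ} (hg : ∀ a, ∑ i, |g.coeff a i| ≤ ρ)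
    (a b : A) : ∑ i, |g.coeff a i - g.coeff b i| ≤ 2 * ρ := by
  calc _ ≤ ∑ i, (|g.coeff a i| + |g.coeff b i|) := Finset.sum_le_sum fun i _ => abs_sub _ _
    _ ≤ _ := by rw [Finset.sum_add_distrib]; linarith [hg a, hg b]

theorem abs_sum_coeff_mul_sub_le {A : Type*} {n : ℕ} {g : LinLoss A n} {ρ : ℝ} (hg : ∀ a, ∑ i, |g.coeff a i| ≤ ρ)
    (a b : A) {u v : Fin n → ℝ} (hu : u ∈ Set.Icc (0 : Fin n → ℝ) 1)
    (hv : v ∈ Set.Icc (0 : Fin n → ℝ) 1) :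
    |∑ i, (g.coeff a i - g.coeff b i) * (v i - u i)| ≤ 2 * ρ := by
  refine (Finset.abs_sum_le_sum_abs _ _).trans
    ((Finset.sum_le_sum fun i _ => ?_).trans (abs_sum_coeff_mul_le hg a b))
  rw [abs_mul]
  exact mul_le_of_le_one_right (abs_nonneg _) (abs_sub_le_one_of_mem_Icc hv hu i)

variable {X A : Type*} [Fintype A] {d n : ℕ} {η : ℝ}
  {s : Fin n → Cube d → unitInterval}

/-- The swap regret of one round, in terms of the difference of outcome and prediction. -/
theorem sum_quantal_mul_sub_le [Nonempty A] (hη : 0 < η) {ℓ : Loss A d} {g : LinLoss A n} {δ : ℝ}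
    (h : ∀ a y, |g.eval a (basisVec s y) - (ℓ a y : ℝ)| ≤ δ) (p y : Cube d) (c : A → A) :
    ∑ a, quantal η (fun a p => (ℓ a p : ℝ)) p a * ((ℓ a y : ℝ) - (ℓ (c a) y : ℝ)) ≤
      (Real.exp (2 * η * δ) - 1) + 2 * δ + Real.log (Fintype.card A) / η +
      ∑ a, quantal η g.eval (basisVec s p) a *
        ∑ i, (g.coeff a i - g.coeff (c a) i) * (basisVec s y i - basisVec s p i) := by
  set u := basisVec s p
  set v := basisVec s y
  set q := fun a => quantal η (fun a p => (ℓ a p : ℝ)) p a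
  set q' := fun a => quantal η g.eval u a
  have hq' : ∀ a, 0 ≤ q' a := fun a => quantal_nonneg _ _ _
  have hq'1 : ∑ a, q' a = 1 := sum_quantal _ _
  -- `b` is the exact best response to the prediction under `g`; it bounds from below the predicted
  -- loss of every alternative `c a`.
  obtain ⟨b, -, hb⟩ := Finset.exists_min_image Finset.univ (fun a => g.eval a u)
    Finset.univ_nonempty
  have hdiff : ∀ a, |q a - q' a| * 1 + q' a * (2 * δ) + q' a * (g.eval a u - g.eval b u) +
      q' a * ∑ i, (g.coeff a i - g.coeff (c a) i) * (v i - u i)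
        ≥ q a * ((ℓ a y : ℝ) - (ℓ (c a) y : ℝ)) := by
    intro a
    have h1 : |(ℓ a y : ℝ) - (ℓ (c a) y : ℝ)| ≤ 1 := by
      have := (ℓ a y).2.1; have := (ℓ a y).2.2
      have := (ℓ (c a) y).2.1; have := (ℓ (c a) y).2.2
      rw [abs_le]; constructor <;> linarith
    have h2 : (q a - q' a) * ((ℓ a y : ℝ) - (ℓ (c a) y : ℝ)) ≤ |q a - q' a| * 1 := by
      refine (le_abs_self _).trans ?_
      rw [abs_mul]
      exact mul_le_mul_of_nonneg_left h1 (abs_nonneg _)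
    have h3 := (abs_le.1 (h a y)).1
    have h4 := (abs_le.1 (h (c a) y)).2
    have h5 : g.eval a v - g.eval (c a) v = g.eval a u - g.eval (c a) u +
        ∑ i, (g.coeff a i - g.coeff (c a) i) * (v i - u i) := by
      simp only [LinLoss.eval, sub_mul, mul_sub, Finset.sum_sub_distrib]; ring
    have h6 := hb (c a) (Finset.mem_univ _)
    have h7 : (ℓ a y : ℝ) - (ℓ (c a) y : ℝ) ≤ 2 * δ + (g.eval a u - g.eval b u) +
        ∑ i, (g.coeff a i - g.coeff (c a) i) * (v i - u i) := by linarith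
    have h8 := mul_le_mul_of_nonneg_left h7 (hq' a)
    linarith
  refine (Finset.sum_le_sum fun a _ => hdiff a).trans ?_
  simp only [Finset.sum_add_distrib, ← Finset.sum_mul, mul_one, hq'1, one_mul]
  have h1 := sum_abs_quantal_sub_le (η := η) hη.le (ℓ := fun a p => (ℓ a p : ℝ)) (g := g.eval)
    (p := p) (u := u) (δ := δ) (fun a => by rw [abs_sub_comm]; exact h a p)
  have h2 := sum_quantal_mul_le hη g.eval u b
  have h1' : ∑ a, |q a - q' a| ≤ Real.exp (2 * η * δ) - 1 := h1
  have h2' : ∑ a, q' a * (g.eval a u - g.eval b u) ≤ Real.log (Fintype.card A) / η := h2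
  linarith

theorem integrable_swap [Nonempty A] {μ : Measure (Cube d)} [IsProbabilityMeasure μ] {ℓ : Loss A d}
    (hℓ : ∀ a, AEMeasurable (fun p => (ℓ a p : ℝ)) μ) (y : Cube d) (c : A → A) :
    Integrable (fun p => ∑ a, quantal η (fun a p => (ℓ a p : ℝ)) p a *
      ((ℓ a y : ℝ) - (ℓ (c a) y : ℝ))) μ := by
  refine integrable_finsetSum _ fun a _ => Integrable.mul_const ?_ _
  have hm : AEMeasurable (fun p => quantal η (fun a p => (ℓ a p : ℝ)) p a) μ := by
    unfold quantal
    refine AEMeasurable.div ?_ ?_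
    · exact Real.measurable_exp.comp_aemeasurable ((hℓ a).const_mul _)
    · exact Finset.aemeasurable_fun_sum _ fun b _ =>
        Real.measurable_exp.comp_aemeasurable ((hℓ b).const_mul _)
  refine Integrable.of_bound hm.aestronglyMeasurable 1 (Filter.Eventually.of_forall fun p => ?_)
  rw [Real.norm_eq_abs, abs_of_nonneg (quantal_nonneg _ _ _)]
  exact quantal_le_one _ _ _

/-- Whatever is predicted, the regret in one round is small if the losses hardly depend on the
outcome. -/
theorem integral_swap_le_of_isLinearApprox [Nonempty A] (hη : 0 < η) {lam δ : ℝ} (hlam : 0 ≤ lam)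
    {ℓ : Loss A d} {g : LinLoss A n} (hg : IsLinearApprox s lam δ ℓ g) {μ : Measure (Cube d)}
    [IsProbabilityMeasure μ] (hℓ : ∀ a, AEMeasurable (fun p => (ℓ a p : ℝ)) μ) (y : Cube d)
    (c : A → A) :
    ∫ p, ∑ a, quantal η (fun a p => (ℓ a p : ℝ)) p a * ((ℓ a y : ℝ) - (ℓ (c a) y : ℝ)) ∂μ ≤
      (Real.exp (2 * η * δ) - 1) + 2 * δ + Real.log (Fintype.card A) / η + 2 * lam := by
  refine (integral_mono (integrable_swap hℓ y c) (integrable_const _) fun p =>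
    (sum_quantal_mul_sub_le hη hg.1 p y c).trans
      (add_le_add_right (c := 2 * lam) (?_ : _ ≤ 2 * lam) _)).trans_eq (by simp)
  calc _ ≤ ∑ a, quantal η g.eval (basisVec s p) a * (2 * lam) :=
        Finset.sum_le_sum fun a _ => mul_le_mul_of_nonneg_left ((le_abs_self _).trans
          (abs_sum_coeff_mul_sub_le (hg.sum_abs_coeff_le hlam) a (c a) (basisVec_mem_Icc s p)
            (basisVec_mem_Icc s y))) (quantal_nonneg _ _ _)
    _ = _ := by rw [← Finset.sum_mul, sum_quantal, one_mul]

section Experts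

variable {Lγ : Finset (LinLoss A n)} {C : Finset (X → A)}

open scoped Classical in
/-- The triples whose event belongs to a policy and a loss in `S`. -/
def policyExperts (S : Finset (LinLoss A n)) : Finset (Expert Lγ C) :=
  (((S.subtype (· ∈ Lγ)) ×ˢ (Finset.univ : Finset (A × A × C))).map
    Function.Embedding.inr) ×ˢ Finset.univ

theorem mem_policyExperts {S : Finset (LinLoss A n)} {g : Lγ} (hg : g.1 ∈ S) (a b : A) (c : C)
    (i : Fin n) (σ : Bool) :
    ((Sum.inr (g, a, b, c), i, σ) : Expert Lγ C) ∈ policyExperts S := by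
  simp [policyExperts, hg]

theorem card_policyExperts_le (S : Finset (LinLoss A n)) :
    ((policyExperts S : Finset (Expert Lγ C)).card : ℝ) ≤
      S.card * (2 * Fintype.card A ^ 2 * n * C.card) := by
  classical
  have h : (policyExperts S : Finset (Expert Lγ C)).card ≤
      S.card * (2 * Fintype.card A ^ 2 * n * C.card) := by
    simp only [policyExperts, Finset.card_product, Finset.card_map, Finset.card_univ,
      Fintype.card_prod, Fintype.card_fin, Fintype.card_bool, Fintype.card_coe,
      Finset.card_subtype]
    have := Finset.card_filter_le S (· ∈ Lγ)
    calc _ ≤ S.card * (Fintype.card A * (Fintype.card A * C.card)) * (n * 2) := by gcongr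
      _ = _ := by ring
  exact_mod_cast h

theorem bias_false (E : Event Lγ C) (i : Fin n) (x : X) (p v : Fin n → ℝ) :
    bias η (E, i, false) x p v = -bias η (E, i, true) x p v := by
  simp [bias]

/-- The indicator of `c_a(x) = b` trades the context-dependent coefficient for a sum over `b` with
fixed coefficients, which can be pulled out of the sum over rounds. -/
theorem sum_quantal_mul_eq_sum_bias (g : Lγ) (c : A → C) (x : X) (p v : Fin n → ℝ) :
    ∑ a, quantal η g.1.eval p a *
        ∑ i, (g.1.coeff a i - g.1.coeff ((c a).1 x) i) * (v i - p i) =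
      -∑ a, ∑ b, ∑ i, (g.1.coeff a i - g.1.coeff b i) *
        bias η (Sum.inr (g, a, b, c a), i, true) x p v := by
  classical
  rw [← Finset.sum_neg_distrib]
  refine Finset.sum_congr rfl fun a _ => ?_
  rw [Finset.sum_eq_single ((c a).1 x)]
  · rw [Finset.mul_sum, ← Finset.sum_neg_distrib]
    refine Finset.sum_congr rfl fun i _ => ?_
    simp only [bias, Event.val, if_true]; ring
  · intro b _ hb
    refine Finset.sum_eq_zero fun i _ => ?_
    simp [bias, Event.val, Ne.symm hb]
  · simp

theorem sum_val_eq_one [Nonempty A] (g : Lγ) (c : A → C) (x : X) (p : Fin n → ℝ) :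
    ∑ a, ∑ b, Event.val (Lγ := Lγ) (C := C) η (Sum.inr (g, a, b, c a)) x p = 1 := by
  classical
  rw [← sum_quantal (η := η) g.1.eval p]
  refine Finset.sum_congr rfl fun a _ => ?_
  simp [Event.val]

/-- The bias of unbiased prediction on the events of one loss and of one assignment of policies. -/
theorem IsUnbiasedPrediction.sum_integral_quantal_le [Nonempty A]
    (hconv : Convex ℝ (basisImage s))
    {S : Finset (LinLoss A n)} {θ tol : ℝ} (hθ0 : 0 < θ) (hθ : θ ≤ 1 / 2) (htol : 0 ≤ tol)
    {F : Forecaster X n (Fin n → ℝ)}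
    (hF : IsUnbiasedPrediction η tol (basisImage s)
      (expRule (policyExperts S : Finset (Expert Lγ C)) θ) F)
    (x : ℕ → X) {v : ℕ → Fin n → ℝ} (hv : ∀ t, v t ∈ basisImage s) {T : ℕ} {g : Lγ}
    (hgS : g.1 ∈ S) {ρ : ℝ} (hg : ∀ a, ∑ i, |g.1.coeff a i| ≤ ρ) (c : A → C) {Q : ℝ}
    (hQ : Real.log (policyExperts S : Finset (Expert Lγ C)).card + θ * tol * T ≤ Q) :
    ∑ t ∈ Finset.range T, ∫ p, ∑ a, quantal η g.1.eval p a *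
        ∑ i, (g.1.coeff a i - g.1.coeff ((c a).1 (x t)) i) * (v t i - p i)
          ∂(F (history x v t) (x t)) ≤
      2 * ρ * (θ * T + Fintype.card A ^ 2 * (Q / θ)) := by
  have hK := basisImage_subset_Icc s
  have hdist : ∀ t, IsDistributionOn (basisImage s) (F (history x v t) (x t)) := fun t =>
    (hF _ (history_mem (x := x) hv t) (x t)).1
  set G : Expert Lγ C → ℕ → ℝ := fun j t =>
    ∫ p, bias η j (x t) p (v t) ∂(F (history x v t) (x t)) with hG
  set m : A → A → ℕ → ℝ := fun a b t =>
    ∫ p, Event.val (Lγ := Lγ) (C := C) η (Sum.inr (g, a, b, c a)) (x t) p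
      ∂(F (history x v t) (x t)) with hm
  have hm0 : ∀ a b t, 0 ≤ m a b t := fun a b t => integral_nonneg fun p => Event.val_nonneg _ _ _
  have hm1 : ∀ a b t, m a b t ≤ 1 := fun a b t => (hdist t).integral_val_le_one hK _ _
  have hGm : ∀ a b i σ t, |G (Sum.inr (g, a, b, c a), i, σ) t| ≤ m a b t := fun a b i σ t =>
    (hdist t).abs_integral_bias_le hK _ (x t) (hv t)
  -- For a fixed loss and assignment of policies the events share the unit mass of each round. This
  -- saves a factor `|A|²` in the quadratic term.
  have hmsum : ∑ a, ∑ b, ∑ t ∈ Finset.range T, m a b t = T := by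
    have h1 : ∀ t, ∑ a, ∑ b, m a b t = 1 := by
      intro t
      have := (hdist t).1
      have hint : ∀ a b, Integrable (fun p => Event.val (Lγ := Lγ) (C := C) η
          (Sum.inr (g, a, b, c a)) (x t) p) (F (history x v t) (x t)) := fun a b =>
        (hdist t).integrable hK (Event.continuous_val _ _)
      simp only [hm]
      calc _ = ∫ p, ∑ a, ∑ b, Event.val (Lγ := Lγ) (C := C) η (Sum.inr (g, a, b, c a)) (x t) p
            ∂(F (history x v t) (x t)) := by
            rw [integral_finsetSum _ fun a _ => integrable_finsetSum _ fun b _ => hint a b]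
            exact Finset.sum_congr rfl fun a _ => (integral_finsetSum _ fun b _ => hint a b).symm
        _ = 1 := by simp [sum_val_eq_one]
    have h2 : ∀ a, ∑ b, ∑ t ∈ Finset.range T, m a b t = ∑ t ∈ Finset.range T, ∑ b, m a b t :=
      fun a => Finset.sum_comm
    simp only [h2]
    rw [Finset.sum_comm]
    simp [h1]
  have hsq : ∀ a b i σ, ∑ t ∈ Finset.range T, G (Sum.inr (g, a, b, c a), i, σ) t ^ 2
      ≤ ∑ t ∈ Finset.range T, m a b t := by
    intro a b i σ
    refine Finset.sum_le_sum fun t _ => ?_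
    rw [← sq_abs]
    have := hGm a b i σ t
    nlinarith [abs_nonneg (G (Sum.inr (g, a, b, c a), i, σ) t), hm1 a b t]
  have hreg : ∀ a b i σ, ∑ t ∈ Finset.range T, G (Sum.inr (g, a, b, c a), i, σ) t
      ≤ θ * ∑ t ∈ Finset.range T, m a b t + Q / θ := by
    intro a b i σ
    have h1 := hF.sum_bias_le hconv hθ0.le hθ htol x hv T (mem_policyExperts hgS a b (c a) i σ)
    have h2 := mul_le_mul_of_nonneg_left (hsq a b i σ) (sq_nonneg θ)
    have h3 : θ * ∑ t ∈ Finset.range T, G (Sum.inr (g, a, b, c a), i, σ) t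
        ≤ θ * (θ * ∑ t ∈ Finset.range T, m a b t + Q / θ) := by
      rw [mul_add, mul_div_cancel₀ _ hθ0.ne']
      simp only [hG] at h2 ⊢
      linarith
    exact le_of_mul_le_mul_left h3 hθ0
  -- Both signs of the bias are triples, so the one-sided bounds give the absolute value.
  have habs : ∀ a b i, |∑ t ∈ Finset.range T, G (Sum.inr (g, a, b, c a), i, true) t|
      ≤ θ * ∑ t ∈ Finset.range T, m a b t + Q / θ := by
    intro a b i
    have h1 := hreg a b i false
    have h2 : ∀ t, G (Sum.inr (g, a, b, c a), i, false) t
        = -G (Sum.inr (g, a, b, c a), i, true) t := fun t => by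
      simp only [hG, bias_false, integral_neg]
    simp only [h2, Finset.sum_neg_distrib] at h1
    exact abs_le.2 ⟨by linarith, hreg a b i true⟩
  have hint : ∀ t, ∫ p, ∑ a, quantal η g.1.eval p a *
        ∑ i, (g.1.coeff a i - g.1.coeff ((c a).1 (x t)) i) * (v t i - p i)
          ∂(F (history x v t) (x t)) =
      -∑ a, ∑ b, ∑ i, (g.1.coeff a i - g.1.coeff b i) *
        G (Sum.inr (g, a, b, c a), i, true) t := by
    intro t
    have hb : ∀ a b i, Integrable (fun p => (g.1.coeff a i - g.1.coeff b i) *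
        bias η ((Sum.inr (g, a, b, c a), i, true) : Expert Lγ C) (x t) p (v t))
        (F (history x v t) (x t)) := fun a b i =>
      ((hdist t).integrable hK (continuous_bias _ _ _)).const_mul _
    simp only [sum_quantal_mul_eq_sum_bias, integral_neg]
    rw [integral_finsetSum _ fun a _ => integrable_finsetSum _ fun b _ =>
      integrable_finsetSum _ fun i _ => hb a b i]
    congr 1
    refine Finset.sum_congr rfl fun a _ => ?_
    rw [integral_finsetSum _ fun b _ => integrable_finsetSum _ fun i _ => hb a b i]
    refine Finset.sum_congr rfl fun b _ => ?_
    rw [integral_finsetSum _ fun i _ => hb a b i]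
    exact Finset.sum_congr rfl fun i _ => integral_const_mul _ _
  simp only [hint, Finset.sum_neg_distrib]
  rw [Finset.sum_comm]
  have hswap : ∀ a, ∑ t ∈ Finset.range T, ∑ b, ∑ i, (g.1.coeff a i - g.1.coeff b i) *
        G (Sum.inr (g, a, b, c a), i, true) t =
      ∑ b, ∑ i, (g.1.coeff a i - g.1.coeff b i) *
        ∑ t ∈ Finset.range T, G (Sum.inr (g, a, b, c a), i, true) t := by
    intro a
    rw [Finset.sum_comm]
    refine Finset.sum_congr rfl fun b _ => ?_
    rw [Finset.sum_comm]
    exact Finset.sum_congr rfl fun i _ => (Finset.mul_sum _ _ _).symm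
  simp only [hswap, ← Finset.sum_neg_distrib]
  have hQ0 : ∀ a b, 0 ≤ θ * ∑ t ∈ Finset.range T, m a b t + Q / θ := by
    intro a b
    -- Without coordinates there is no bias to compare with; nonnegativity of `Q` is then read off
    -- from `hQ`.
    rcases isEmpty_or_nonempty (Fin n) with hn | ⟨⟨i⟩⟩
    · have h1 : (0 : ℝ) ≤ Real.log (policyExperts S : Finset (Expert Lγ C)).card :=
        Real.log_natCast_nonneg _
      have : 0 ≤ Q := le_trans (by positivity) hQ
      have := Finset.sum_nonneg fun t (_ : t ∈ Finset.range T) => hm0 a b t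
      positivity
    · exact (abs_nonneg _).trans (habs a b i)
  calc _ ≤ ∑ a, ∑ b, 2 * ρ * (θ * ∑ t ∈ Finset.range T, m a b t + Q / θ) := by
        refine Finset.sum_le_sum fun a _ => Finset.sum_le_sum fun b _ => ?_
        calc _ ≤ ∑ i, |g.1.coeff a i - g.1.coeff b i| *
              (θ * ∑ t ∈ Finset.range T, m a b t + Q / θ) := by
              refine Finset.sum_le_sum fun i _ => ?_
              refine (neg_le_abs _).trans ?_
              rw [abs_mul]
              exact mul_le_mul_of_nonneg_left (habs a b i) (abs_nonneg _)
          _ ≤ _ := by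
              rw [← Finset.sum_mul]
              exact mul_le_mul_of_nonneg_right (abs_sum_coeff_mul_le hg a b) (hQ0 a b)
    _ = _ := by
        simp only [← Finset.mul_sum, Finset.sum_add_distrib, hmsum]
        simp only [Finset.sum_const, Finset.card_univ, nsmul_eq_mul]; ring

end Experts
end RegretBound

/-! ### Size of the logarithm. -/

/-- Every factor of the count is a bounded power of `Y = n r N c T`, with total exponent `2nN + 5N +
3 ≤ 9nN`. The hypothesis `2 ≤ N` ensures `Y ≥ 2`, so that `log Y` stays away from `0` and numerical
constants become powers of `Y`. -/
theorem log_le_of_card_le {n N c T : ℕ} {r m : ℝ} (hn : 0 < n) (hN : 2 ≤ N) (hc : 0 < c)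
    (hT : 0 < T) (hr : 1 ≤ r) (hm : 0 < m)
    (h : m ≤ (4 * r) ^ (n * N) * (⌈(4 + 8 * N) * r⌉₊ + 1 : ℝ) ^ N * (2 * N ^ 2 * n * c)) :
    Real.log m ≤ 9 * (n * N * Real.log (n * r * N * c * T)) ∧
      1 / 2 ≤ Real.log (n * r * N * c * T) := by
  have hn' : (1 : ℝ) ≤ n := by exact_mod_cast hn
  have hN' : (2 : ℝ) ≤ N := by exact_mod_cast hN
  have hc' : (1 : ℝ) ≤ c := by exact_mod_cast hc
  have hT' : (1 : ℝ) ≤ T := by exact_mod_cast hT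
  set Y : ℝ := n * r * N * c * T with hY
  have hY1 : r * N ≤ Y := by
    have h1 : 1 ≤ n * (c * T : ℝ) := one_le_mul_of_one_le_of_one_le hn'
      (one_le_mul_of_one_le_of_one_le hc' hT')
    calc r * N = r * N * 1 := by ring
      _ ≤ r * N * (n * (c * T)) := by gcongr
      _ = Y := by rw [hY]; ring
  have hY2 : n * N * c ≤ Y := by
    have h1 : 1 ≤ r * (T : ℝ) := one_le_mul_of_one_le_of_one_le hr hT'
    calc (n * N * c : ℝ) = n * N * c * 1 := by ring
      _ ≤ n * N * c * (r * T) := by gcongr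
      _ = Y := by rw [hY]; ring
  have hYN : (N : ℝ) ≤ Y := by nlinarith
  have hY2' : 2 ≤ Y := hN'.trans hYN
  have hYr : 2 * r ≤ Y := by nlinarith
  have hY0 : 0 < Y := by linarith
  set Λ := Real.log Y with hΛ
  have hΛ0 : 1 / 2 ≤ Λ := by
    have h1 := Real.log_le_log (by norm_num) hY2'
    have := Real.log_two_gt_d9
    linarith
  refine ⟨?_, hΛ0⟩
  have e1 : 4 * r ≤ Y ^ 2 := by nlinarith
  have e2 : (⌈(4 + 8 * N) * r⌉₊ + 1 : ℝ) ≤ Y ^ 5 := by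
    have h1 := (Nat.ceil_lt_add_one (a := (4 + 8 * (N : ℝ)) * r) (by positivity)).le
    have h2 : (16 : ℝ) ≤ Y ^ 4 := by
      calc (16 : ℝ) = 2 ^ 4 := by norm_num
        _ ≤ Y ^ 4 := by gcongr
    have h3 : (4 + 8 * N) * r + 1 + 1 ≤ 16 * Y := by nlinarith
    calc (⌈(4 + 8 * N) * r⌉₊ + 1 : ℝ) ≤ 16 * Y := by linarith
      _ ≤ Y ^ 4 * Y := by gcongr
      _ = Y ^ 5 := by ring
  have e3 : (2 * N ^ 2 * n * c : ℝ) ≤ Y ^ 3 := by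
    calc (2 * N ^ 2 * n * c : ℝ) = 2 * N * (n * N * c) := by ring
      _ ≤ Y * Y * Y := by gcongr
      _ = Y ^ 3 := by ring
  have hle : m ≤ Y ^ (2 * (n * N) + 5 * N + 3) := by
    calc m ≤ (Y ^ 2) ^ (n * N) * (Y ^ 5) ^ N * Y ^ 3 := h.trans (by gcongr)
      _ = _ := by rw [← pow_mul, ← pow_mul, ← pow_add, ← pow_add]
  have hlog := Real.log_le_log hm hle
  rw [Real.log_pow] at hlog
  refine hlog.trans ?_
  rw [← hΛ, show 9 * (n * N * Λ) = 9 * (n * N) * Λ by ring]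
  refine mul_le_mul_of_nonneg_right ?_ (by linarith)
  push_cast
  nlinarith [mul_le_mul_of_nonneg_right hn' (by linarith : (0 : ℝ) ≤ N)]

theorem hasDecisionSwapRegret_of_subsingleton {X A : Type*} [Fintype A] [Subsingleton A] {d : ℕ}
    {L : Set (Loss A d)} {C : Finset (X → A)} {ε : ℝ} (hε : 0 ≤ ε)
    (k : Loss A d → Cube d → A → ℝ) (T : ℕ) (x : ℕ → X) (y : ℕ → Cube d)
    (μ : ℕ → Measure (Cube d)) : HasDecisionSwapRegret L C ε k T x y μ := by
  intro ℓ _ c _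
  have : ∀ t a, (ℓ a (y t) : ℝ) - (ℓ (c a (x t)) (y t) : ℝ) = 0 := fun t a => by
    rw [Subsingleton.elim (c a (x t)) a, sub_self]
  simpa [this] using hε

/-! ### Regret bounds in the trivial and in the main regime. -/

section Main

variable {X A : Type*} [Fintype A] [Nonempty A] {d n : ℕ} {η : ℝ}
  {s : Fin n → Cube d → unitInterval} {L : Set (Loss A d)} {lam δ γ : ℝ}
  {Lγ : Finset (LinLoss A n)} {C : Finset (X → A)}

theorem history_basisVec_mem (x : ℕ → X) (y : ℕ → Cube d) (t : ℕ) :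
    ∀ r ∈ history x (fun r => basisVec s (y r)) t, r.2 ∈ basisImage s :=
  history_mem (fun t => Set.mem_range_self (y t)) t

theorem average_le {T : ℕ} (hT : 0 < T) {f : ℕ → ℝ} {b c : ℝ}
    (h : ∑ t ∈ Finset.range T, f t ≤ T * b + T * c) :
    1 / (T : ℝ) * ∑ t ∈ Finset.range T, f t ≤ b + c := by
  have hT' : (0 : ℝ) < T := by exact_mod_cast hT
  rw [one_div, inv_mul_le_iff₀ hT', mul_add]
  exact h

/-- The regret bound when the losses hardly depend on the outcome. -/
theorem hasDecisionSwapRegret_of_isLinearApprox (hη : 0 < η) (hlam : 0 ≤ lam) {T : ℕ} (hT : 0 < T)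
    (hL : ∀ ℓ ∈ L, ∃ g : LinLoss A n, IsLinearApprox s lam δ ℓ g) {tol : ℝ}
    {W : List (Expert Lγ C → ℝ) → Expert Lγ C → ℝ} {B : Forecaster X n (Cube d)}
    (hB : IsSmoothDecisionSwap s L η tol W B) (x : ℕ → X) (y : ℕ → Cube d) {ε : ℝ}
    (hε : (Real.exp (2 * η * δ) - 1) + 2 * δ + Real.log (Fintype.card A) / η + 2 * lam ≤ ε) :
    HasDecisionSwapRegret L C ε (fun ℓ => quantal η (fun a p => (ℓ a p : ℝ))) T x y
      (fun t => B (history x (fun r => basisVec s (y r)) t) (x t)) := by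
  obtain ⟨F, -, hFB⟩ := hB
  intro ℓ hℓ c _
  obtain ⟨g, hg⟩ := hL ℓ hℓ
  refine (average_le hT (b := ε) (c := 0) ?_).trans_eq (add_zero ε)
  refine (Finset.sum_le_card_nsmul _ _ ε fun t _ => ?_).trans_eq (by simp)
  obtain ⟨hp, -, -, hm⟩ := hFB _ (history_basisVec_mem x y t) (x t)
  exact (integral_swap_le_of_isLinearApprox hη hlam hg (hm ℓ hℓ) (y t) fun a => c a (x t)).trans hε

/-- Truncating the offsets of the constants costs at most `1 / η`. -/
theorem sum_quantal_coeff_le_of_offset (hη : 0 < η) (hlam : 0 < lam) {g h : LinLoss A n}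
    (hcoeff : h.coeff = g.coeff) (hg : ∀ a, ∑ i, |g.coeff a i| ≤ 2 * lam) {kg kh G : ℝ}
    {og oh : A → ℝ} (hkg : ∀ a, g.const a = kg + og a) (hkh : ∀ a, h.const a = kh + oh a)
    (hog : ∃ b, og b = 0) (ho : ∀ a, og a = oh a ∨ (G ≤ og a ∧ G ≤ oh a))
    (hG : (4 + 8 * Fintype.card A) * lam ≤ G) (c : A → A) {u v : Fin n → ℝ}
    (hu : u ∈ Set.Icc (0 : Fin n → ℝ) 1) (hv : v ∈ Set.Icc (0 : Fin n → ℝ) 1) :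
    ∑ a, quantal η g.eval u a * ∑ i, (g.coeff a i - g.coeff (c a) i) * (v i - u i) ≤
      ∑ a, quantal η h.eval u a * ∑ i, (h.coeff a i - h.coeff (c a) i) * (v i - u i) + 1 / η := by
  rw [hcoeff, ← sub_le_iff_le_add', ← Finset.sum_sub_distrib]
  have hf : ∀ a, |∑ i, g.coeff a i * u i| ≤ 2 * lam := fun a => by
    refine (Finset.abs_sum_le_sum_abs _ _).trans ((Finset.sum_le_sum fun i _ => ?_).trans (hg a))
    rw [abs_mul]
    refine mul_le_of_le_one_right (abs_nonneg _) ?_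
    rw [abs_of_nonneg (hu.1 i)]
    exact hu.2 i
  have hclose := sum_abs_quantal_sub_le_of_offset hη.le (g := g.eval) (h := h.eval) (p := u)
    (f := fun a => ∑ i, g.coeff a i * u i) (R := 2 * lam) (G := G)
    (fun a => by rw [LinLoss.eval, hkg]) (fun a => by rw [LinLoss.eval, hkh, hcoeff]) hf hog ho
  have hN : (0 : ℝ) < Fintype.card A := by exact_mod_cast Fintype.card_pos
  set N : ℝ := (Fintype.card A : ℝ)
  -- The choice of `G` leaves `G - 4 lam ≥ 8 N lam`. With `x = 8 N η lam` the total cost is then at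
  -- most `x exp (-x) / η ≤ 1 / η`.
  have hexp : Real.exp (-η * (G - 2 * (2 * lam))) ≤ Real.exp (-(8 * N * η * lam)) := by
    apply Real.exp_le_exp.2
    nlinarith
  have hx : (8 * N * η * lam) * Real.exp (-(8 * N * η * lam)) ≤ 1 := by
    rw [Real.exp_neg, ← div_eq_mul_inv, div_le_one (Real.exp_pos _)]
    linarith [Real.add_one_le_exp (8 * N * η * lam)]
  calc _ ≤ ∑ a, |quantal η g.eval u a - quantal η h.eval u a| * (2 * (2 * lam)) := by
        refine Finset.sum_le_sum fun a _ => ?_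
        rw [← sub_mul]
        refine (le_abs_self _).trans ?_
        rw [abs_mul]
        exact mul_le_mul_of_nonneg_left (abs_sum_coeff_mul_sub_le hg a (c a) hu hv) (abs_nonneg _)
    _ ≤ 2 * N * Real.exp (-(8 * N * η * lam)) * (2 * (2 * lam)) := by
        rw [← Finset.sum_mul]
        refine mul_le_mul_of_nonneg_right (hclose.trans ?_) (by positivity)
        exact mul_le_mul_of_nonneg_left hexp (by positivity)
    _ ≤ 1 / η := by
        rw [le_div_iff₀ hη]
        linarith

/-- The regret bound when the learning rate of the weights is small. -/
theorem hasDecisionSwapRegret_of_learningRate (hη : 0 < η) (hγ : 0 < γ) (hn : 0 < n)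
    (hlam : n * γ < lam) {T : ℕ} (hT : 0 < T)
    (hLγ : IsDiscretizedFamily s lam δ γ L Lγ) (hconv : Convex ℝ (basisImage s)) {G : ℝ}
    (hG : (4 + 8 * Fintype.card A) * lam ≤ G) {S : Finset (LinLoss A n)}
    (hSL : S ⊆ Lγ) (hS : ∀ g ∈ Lγ, ∃ h ∈ S, h.coeff = g.coeff ∧ ∃ (kg kh : ℝ) (og oh : A → ℝ),
        (∀ a, g.const a = kg + og a) ∧ (∀ a, h.const a = kh + oh a) ∧ (∃ b, og b = 0) ∧
        ∀ a, og a = oh a ∨ (G ≤ og a ∧ G ≤ oh a))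
    {θ tol Q : ℝ} (hθ0 : 0 < θ) (hθ : θ ≤ 1 / 2) (htol : 0 ≤ tol)
    (hQ : Real.log (policyExperts S : Finset (Expert Lγ C)).card + θ * tol * T ≤ Q)
    {B : Forecaster X n (Cube d)}
    (hB : IsSmoothDecisionSwap s L η tol
      (expRule (policyExperts S : Finset (Expert Lγ C)) θ) B) (x : ℕ → X) (y : ℕ → Cube d) {ε : ℝ}
    (hε : (Real.exp (2 * η * (δ + n * γ)) - 1) + 2 * (δ + n * γ)
      + Real.log (Fintype.card A) / η + 1 / η
      + 4 * lam * (θ + Fintype.card A ^ 2 * (Q / θ) / T) ≤ ε) :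
    HasDecisionSwapRegret L C ε (fun ℓ => quantal η (fun a p => (ℓ a p : ℝ))) T x y
      (fun t => B (history x (fun r => basisVec s (y r)) t) (x t)) := by
  obtain ⟨F, hF, hFB⟩ := hB
  intro ℓ hℓ c hc
  have hT' : (0 : ℝ) < T := by exact_mod_cast hT
  have hn' : (1 : ℝ) ≤ n := by exact_mod_cast hn
  have hlam0 : 0 < lam := by nlinarith
  obtain ⟨rep, hrep, hcoe⟩ := hLγ
  set g := (rep ℓ).snap γ with hgdef
  have hgL : g ∈ Lγ := by rw [← Finset.mem_coe, hcoe]; exact ⟨ℓ, hℓ, rfl⟩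
  -- Rounding `n + 1` coefficients costs `(n + 1) γ / 2 ≤ n γ`, as `n ≥ 1`.
  have hclose : ∀ a y, |g.eval a (basisVec s y) - (ℓ a y : ℝ)| ≤ δ + n * γ := fun a y => by
    have h1 := abs_snap_eval_sub_le hγ (rep ℓ) a (basisVec_mem_Icc s y)
    have h2 := (hrep ℓ hℓ).1 a y
    have h3 := abs_sub_le (g.eval a (basisVec s y)) ((rep ℓ).eval a (basisVec s y)) (ℓ a y : ℝ)
    nlinarith
  have hgc : ∀ a, ∑ i, |g.coeff a i| ≤ 2 * lam := fun a => by
    have h1 := sum_abs_snap_coeff_le hγ (rep ℓ) a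
    have h2 := (hrep ℓ hℓ).sum_abs_coeff_le hlam0.le a
    nlinarith
  -- The triples of `g` itself may carry no weight; the bias bound is applied to its representative
  -- `h`.
  obtain ⟨h, hhS, hcoeff, kg, kh, og, oh, hkg, hkh, hog, ho⟩ := hS g hgL
  have hK := basisImage_subset_Icc s
  set v : ℕ → Fin n → ℝ := fun r => basisVec s (y r) with hv
  set E₀ : ℝ := (Real.exp (2 * η * (δ + n * γ)) - 1) + 2 * (δ + n * γ)
      + Real.log (Fintype.card A) / η + 1 / η with hE₀
  let Ψ : ℕ → (Fin n → ℝ) → ℝ := fun t p => ∑ a, quantal η h.eval p a *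
    ∑ i, (h.coeff a i - h.coeff (c a (x t)) i) * (v t i - p i)
  have hΨ : ∀ t, Continuous (Ψ t) := fun t => by
    have := fun a => continuous_quantal (η := η) h a
    exact continuous_finsetSum _ fun a _ => (this a).mul (by fun_prop)
  have hround : ∀ t, ∫ p, ∑ a, quantal η (fun a p => (ℓ a p : ℝ)) p a *
      ((ℓ a (y t) : ℝ) - (ℓ (c a (x t)) (y t) : ℝ)) ∂(B (history x v t) (x t))
      ≤ E₀ + ∫ p, Ψ t p ∂(F (history x v t) (x t)) := by
    intro t
    obtain ⟨hp, haem, hmap, hm⟩ := hFB _ (history_basisVec_mem x y t) (x t)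
    have hdist := (hF _ (history_basisVec_mem x y t) (x t)).1
    have hint := hdist.integrable hK (hΨ t)
    have hint' : Integrable (fun p => Ψ t (basisVec s p)) (B (history x v t) (x t)) := by
      rw [← hmap] at hint
      exact hint.comp_aemeasurable haem
    have h1 : ∫ p, Ψ t p ∂(F (history x v t) (x t))
        = ∫ p, Ψ t (basisVec s p) ∂(B (history x v t) (x t)) := by
      rw [← hmap]
      exact integral_map haem (hΨ t).measurable.aestronglyMeasurable
    rw [h1]
    calc _ ≤ ∫ p, (E₀ + Ψ t (basisVec s p)) ∂(B (history x v t) (x t)) := by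
          refine integral_mono (integrable_swap (hm ℓ hℓ) (y t) fun a => c a (x t))
            ((integrable_const _).add hint') fun p => ?_
          have h2 := sum_quantal_mul_sub_le hη hclose p (y t) fun a => c a (x t)
          have h3 := sum_quantal_coeff_le_of_offset hη hlam0 hcoeff hgc hkg hkh hog ho hG
            (fun a => c a (x t)) (basisVec_mem_Icc s p) (basisVec_mem_Icc s (y t))
          simp only [hE₀, Ψ, hv]
          linarith
      _ = _ := by rw [integral_add (integrable_const _) hint']; simp
  have hcum := hF.sum_integral_quantal_le hconv hθ0 hθ htol x
    (v := v) (fun t => Set.mem_range_self (y t)) (T := T) (g := ⟨h, hSL hhS⟩) hhS (ρ := 2 * lam)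
    (by rw [hcoeff]; exact hgc) (fun a => ⟨c a, hc a⟩) hQ
  refine (average_le hT (b := E₀) (c := 4 * lam * (θ + Fintype.card A ^ 2 * (Q / θ) / T)) ?_).trans hε
  calc _ ≤ ∑ t ∈ Finset.range T, (E₀ + ∫ p, Ψ t p ∂(F (history x v t) (x t))) :=
        Finset.sum_le_sum fun t _ => hround t
    _ = T * E₀ + ∑ t ∈ Finset.range T, ∫ p, Ψ t p ∂(F (history x v t) (x t)) := by
        rw [Finset.sum_add_distrib]; simp
    _ ≤ T * E₀ + 2 * (2 * lam) * (θ * T + Fintype.card A ^ 2 * (Q / θ)) := by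
        exact add_le_add_right hcum _
    _ = _ := by field_simp; ring

end Main

end DecisionSwap

end

/-! ### Choice of the parameters and degenerate cases. -/

theorem mainTheorem12 :
    ∃ K : ℝ, 0 < K ∧
    ∀ (X A : Type*) [Fintype A] [Nonempty A] (d n T : ℕ), 0 < n → 0 < T →
    ∀ (L : Set (DecisionSwap.Loss A d)) (C : Finset (X → A))
      (s : Fin n → DecisionSwap.Cube d → unitInterval) (lam δ γ η : ℝ),
      L.Nonempty → 0 ≤ lam → 0 < γ → 0 < η →
      DecisionSwap.IsApproxBasis s lam δ (DecisionSwap.lossFunctions L) →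
      Convex ℝ (DecisionSwap.basisImage s) →
      (∃ Lγ : Finset (DecisionSwap.LinLoss A n),
        DecisionSwap.IsDiscretizedFamily s lam δ γ L Lγ) ∧
      ∀ Lγ : Finset (DecisionSwap.LinLoss A n),
        DecisionSwap.IsDiscretizedFamily s lam δ γ L Lγ →
        ∃ W : List (DecisionSwap.Expert Lγ C → ℝ) → DecisionSwap.Expert Lγ C → ℝ,
          DecisionSwap.IsWeightRule W ∧
          ∀ tol : ℝ, 0 ≤ tol → tol ≤ 1 / ((Fintype.card A : ℝ) * T) →
            (0 < tol ∨ IsClosed (DecisionSwap.basisImage s) →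
              ∃ B : DecisionSwap.Forecaster X n (DecisionSwap.Cube d),
                DecisionSwap.IsSmoothDecisionSwap s L η tol W B) ∧
            ∀ B : DecisionSwap.Forecaster X n (DecisionSwap.Cube d),
              DecisionSwap.IsSmoothDecisionSwap s L η tol W B →
              ∀ (x : ℕ → X) (y : ℕ → DecisionSwap.Cube d),
                DecisionSwap.HasDecisionSwapRegret L C
                  ((Real.log (Fintype.card A) + 1) / η
                    + K * (lam * Fintype.card A *
                        √(n * Fintype.card A *
                          Real.log (n * (lam / γ) * Fintype.card A * C.card * T) / T))
                    + 2 * δ + 2 * n * γ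
                    + Fintype.card A * (Real.exp (2 * η * (δ + n * γ)) - 1))
                  (fun ℓ => DecisionSwap.quantal η (fun a p => (ℓ a p : ℝ)))
                  T x y
                  (fun t => B (DecisionSwap.history x
                    (fun r => DecisionSwap.basisVec s (y r)) t) (x t)) := by
  -- With `θ = N r` and `Q = 10 r² T`, the term `4 lam (θ + N² (Q / θ) / T)` equals `4 lam · 11 N
  -- r`.
  refine ⟨44, by norm_num, ?_⟩
  intro X A _ _ d n T hn hT L C s lam δ γ η hL hlam hγ hη hs hconv
  refine ⟨DecisionSwap.exists_isDiscretizedFamily hlam hγ hs hconv, fun Lγ hLγ => ?_⟩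
  have hn' : (1 : ℝ) ≤ n := by exact_mod_cast hn
  have hT' : (1 : ℝ) ≤ T := by exact_mod_cast hT
  have hN' : (1 : ℝ) ≤ Fintype.card A := by exact_mod_cast Fintype.card_pos
  have hlin : ∀ ℓ ∈ L, ∃ g : DecisionSwap.LinLoss A n, DecisionSwap.IsLinearApprox s lam δ ℓ g :=
    fun ℓ hℓ => DecisionSwap.exists_isLinearApprox hlam hs hconv hℓ
  have hδ : 0 ≤ δ := by
    obtain ⟨ℓ, hℓ⟩ := hL
    obtain ⟨g, hg⟩ := hlin ℓ hℓ
    exact (abs_nonneg _).trans (hg.1 (Classical.arbitrary A) fun _ => 0)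
  have hgγ : 0 ≤ n * γ := by positivity
  have hlogN : 0 ≤ Real.log (Fintype.card A) := Real.log_nonneg hN'
  have hexp : Real.exp (2 * η * δ) ≤ Real.exp (2 * η * (δ + n * γ)) :=
    Real.exp_le_exp.2 (mul_le_mul_of_nonneg_left (by linarith) (by positivity))
  have hexp1 : 0 ≤ Real.exp (2 * η * (δ + n * γ)) - 1 :=
    sub_nonneg.2 (Real.one_le_exp (by positivity))
  have hexpN : Real.exp (2 * η * (δ + n * γ)) - 1
      ≤ Fintype.card A * (Real.exp (2 * η * (δ + n * γ)) - 1) := le_mul_of_one_le_left hexp1 hN'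
  have hη1 : 0 ≤ 1 / η := by positivity
  set N : ℝ := (Fintype.card A : ℝ) with hNdef
  set Y : ℝ := n * (lam / γ) * N * C.card * T with hY
  set r := √(n * N * Real.log Y / T) with hr
  have hr0 : 0 ≤ r := Real.sqrt_nonneg _
  -- Outside this regime the bound is trivial, for any weight rule. The condition `N * r ≤ 1 / 2`
  -- makes `N * r` an admissible learning rate.
  by_cases hmain : n * γ < lam ∧ C.Nonempty ∧ 2 ≤ Fintype.card A ∧ N * r ≤ 1 / 2
  · obtain ⟨hlam', hC, hN2, hsmall⟩ := hmain
    have hlam0 : 0 < lam := by linarith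
    have hratio : 1 ≤ lam / γ := by rw [le_div_iff₀ hγ]; nlinarith
    obtain ⟨S, hSL, hSne, hScard, hS⟩ := DecisionSwap.exists_representatives hL hn hγ hlam' hLγ
      ⌈(4 + 8 * N) * (lam / γ)⌉₊
    have hRne : (DecisionSwap.policyExperts S : Finset (DecisionSwap.Expert Lγ C)).Nonempty := by
      obtain ⟨g, hg⟩ := hSne
      obtain ⟨c, hc⟩ := hC
      exact ⟨_, DecisionSwap.mem_policyExperts (g := ⟨g, hSL hg⟩) hg (Classical.arbitrary A)
        (Classical.arbitrary A) ⟨c, hc⟩ ⟨0, hn⟩ true⟩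
    have hRcard := DecisionSwap.card_policyExperts_le (Lγ := Lγ) (C := C) S
    obtain ⟨hlog, hlogY⟩ := DecisionSwap.log_le_of_card_le (n := n) (N := Fintype.card A)
      (c := C.card) (T := T) (r := lam / γ)
      (m := ((DecisionSwap.policyExperts S : Finset (DecisionSwap.Expert Lγ C)).card : ℝ)) hn hN2
      hC.card_pos hT hratio (by exact_mod_cast hRne.card_pos)
      (hRcard.trans (mul_le_mul_of_nonneg_right hScard (by positivity)))
    have hlogY' : 1 / 2 ≤ Real.log Y := hlogY
    have hβ : 0 < n * N * Real.log Y / T := by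
      have : 0 < Real.log Y := by linarith
      positivity
    have hrpos : 0 < r := Real.sqrt_pos.2 hβ
    have hrsq : n * N * Real.log Y = r ^ 2 * T := by
      rw [hr, Real.sq_sqrt hβ.le]; field_simp
    have hG : (4 + 8 * N) * lam ≤ (⌈(4 + 8 * N) * (lam / γ)⌉₊ : ℝ) * γ := by
      have h1 := mul_le_mul_of_nonneg_right (Nat.le_ceil ((4 + 8 * N) * (lam / γ))) hγ.le
      have h2 : (4 + 8 * N) * (lam / γ) * γ = (4 + 8 * N) * lam := by field_simp
      linarith
    refine ⟨DecisionSwap.expRule (DecisionSwap.policyExperts S) (N * r),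
      fun h => DecisionSwap.expRule_mem_stdSimplex hRne h, fun tol htol htol' =>
      ⟨fun h => DecisionSwap.exists_isSmoothDecisionSwap s L _ htol h, fun B hB x y => ?_⟩⟩
    refine DecisionSwap.hasDecisionSwapRegret_of_learningRate hη hγ hn hlam' hT hLγ hconv hG
      hSL hS (by positivity) hsmall htol (Q := 10 * (r ^ 2 * T)) ?_ hB x y ?_
    -- The tolerance contributes at most `1 / 2 ≤ n N log Y`, which raises the factor `9` of the
    -- counting bound to `10`.
    · have h1 : N * r * tol * T ≤ 1 / 2 := by
        have h2 : tol * T ≤ 1 := by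
          rw [le_div_iff₀ (by positivity)] at htol'
          nlinarith [mul_nonneg htol (by positivity : (0 : ℝ) ≤ T)]
        calc N * r * tol * T = N * r * (tol * T) := by ring
          _ ≤ 1 / 2 * 1 := mul_le_mul hsmall h2 (by positivity) (by norm_num)
          _ = 1 / 2 := by norm_num
      have h2 : 1 / 2 ≤ n * N * Real.log Y :=
        hlogY'.trans (le_mul_of_one_le_left (by linarith)
          (one_le_mul_of_one_le_of_one_le hn' hN'))
      rw [← hrsq]
      have h3 : Real.log ((DecisionSwap.policyExperts S :
          Finset (DecisionSwap.Expert Lγ C)).card : ℝ) ≤ 9 * (n * N * Real.log Y) := hlog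
      linarith
    · have h1 : N ^ 2 * (10 * (r ^ 2 * T) / (N * r)) / T = 10 * (N * r) := by
        field_simp
      rw [h1, add_div]
      linarith
  · have : Nonempty (DecisionSwap.Expert Lγ C) := by
      obtain ⟨ℓ, hℓ⟩ := hL
      obtain ⟨rep, -, hcoe⟩ := hLγ
      have hg : (rep ℓ).snap γ ∈ Lγ := by rw [← Finset.mem_coe, hcoe]; exact ⟨ℓ, hℓ, rfl⟩
      exact ⟨Sum.inl (⟨_, hg⟩, Classical.arbitrary A), ⟨0, hn⟩, true⟩
    -- Rate `0` gives uniform weights; any rule would do.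
    refine ⟨DecisionSwap.expRule Finset.univ 0,
      fun h => DecisionSwap.expRule_mem_stdSimplex Finset.univ_nonempty h, fun tol htol _ =>
      ⟨fun h => DecisionSwap.exists_isSmoothDecisionSwap s L _ htol h, fun B hB x y => ?_⟩⟩
    rcases C.eq_empty_or_nonempty with hC | hC
    · intro ℓ _ c hc
      exact absurd (hc (Classical.arbitrary A)) (by simp [hC])
    by_cases hN2 : 2 ≤ Fintype.card A
    · refine DecisionSwap.hasDecisionSwapRegret_of_isLinearApprox hη hlam hT hlin hB x y ?_
      -- The regret never exceeds `2 lam` plus approximation terms. Either `lam ≤ n γ`, which the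
      -- rounding error covers, or `N * r > 1 / 2`, which the square-root term covers.
      have hl : 2 * lam ≤ 44 * (lam * N * r) + 2 * n * γ := by
        rcases le_or_gt lam (n * γ) with h | h
        · have : 0 ≤ lam * N * r := by positivity
          linarith
        · have h1 : 1 / 2 < N * r := by
            by_contra hcon
            exact hmain ⟨h, hC, hN2, not_lt.1 hcon⟩
          nlinarith
      rw [add_div]
      linarith
    · have : Subsingleton A := Fintype.card_le_one_iff_subsingleton.1 (by omega)
      refine DecisionSwap.hasDecisionSwapRegret_of_subsingleton ?_ _ _ _ _ _
      positivity
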